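/- Let $N\ge 2$ be an integer, $p>1$, and let $V:\mathbb R^N\to\mathbb R$ be Lebesgue measurable. Let $A,g:\mathbb R^N\times\mathbb R\to\mathbb R$ be such that $A(\cdot,t)$ and $g(\cdot,t)$ are measurable for all $t$ and, for a.e. $x$, $A(x,\cdot)$ is $C^1$ and $g(x,\cdot)$ is continuous. Put $A_t=\partial A/\partial t$, $G(x,t)=\int_0^t g(x,s)\,ds$, $B_\varrho(x)=\{y:|y-x|<\varrho\}$, $B_\varrho=B_\varrho(0)$, and $p^*=Np/(N-p)$ if $p<N$, $p^*=+\infty$ if $p\ge N$. **Spaces.** For $r\in[1,\infty)$, $|u|_r$ and $|u|_\infty$ are the norms of $L^r(\mathbb R^N)$ and $L^\infty(\mathbb R^N)$. Moreover, $|u|_{V,r}=\big(\int_{\mathbb R^N}V|u|^r\,dx\big)^{1/r}$, and $L^r_V(\mathbb R^N)$ is the set of $u\in L^r(\mathbb R^N)$ with $\int V|u|^r\,dx<\infty$. Let $W^{1,p}_V(\mathbb R^N)=\{u\in W^{1,p}(\mathbb R^N):\int V|u|^p\,dx<\infty\}$ with norm $\|u\|_V=\big(\int|\nabla u|^p\,dx+\int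 V|u|^p\,dx\big)^{1/p}$, and $X=W^{1,p}_V(\mathbb R^N)\cap L^\infty(\mathbb R^N)$ with norm $\|u\|_X=\|u\|_V+|u|_\infty$. For $k\in\{1,2,\dots\}$ let $X_{B_k}$ be the set of $u\in W^{1,p}_0(B_k)\cap L^\infty(B_k)$ with $\int_{B_k} V|u|^p\,dx<\infty$; these functions are extended by $0$ to $\mathbb R^N$, so that $X_{B_k}\subset X$. **Assumptions.** There are constants $\alpha_0,\alpha_1,\alpha_2,a_1,a_2>0$, $\mu>p$, $q$ with $p\le q<p^*$, $\bar\alpha\in\mathbb R$, and $\tau_p>0$ with $|u|_p\le\tau_p\|u\|_V$ for all $u\in W_V^{1,p}(\mathbb R^N)$, such that, for a.e. $x\in\mathbb R^N$ and all $t\in\mathbb R$ where $x$ and $t$ occur freely: * $\operatorname{ess\,inf}V>0$; $\ \lim_{|x|\to\infty}\int_{B_1(x)}\frac{dy}{V(y)}=0$; $\ V$ is essentially bounded on every $B_\varrho$, $\varrho>0$; * $\sup_{|t|\le\rho}|A(\cdot,t)|$ and $\sup_{|t|\le\rho}|A_t(\cdot,t)|$ belong to $L^\infty(\mathbb R^N)$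 for every $\rho>0$; * $A(x,t)\ge\alpha_0$; $\ (\mu-p)A(x,t)-A_t(x,t)t\ge\alpha_1A(x,t)$; $\ pA(x,t)+A_t(x,t)t\ge\alpha_2A(x,t)$; * $|g(x,t)|\le a_1|t|^{p-1}+a_2|t|^{q-1}$; * $\lim_{t\to0}\frac{g(x,t)}{|t|^{p-2}t}=\bar\alpha<\frac{\alpha_0}{\tau_p^p}$ uniformly for a.e. $x$; * $0<\mu G(x,t)\le g(x,t)t$ if $t\neq0$. **Functional.** For $u,v\in X$ set $$\mathcal J(u)=\frac1p\int_{\mathbb R^N}A(x,u)|\nabla u|^p\,dx+\frac1p\int_{\mathbb R^N}V|u|^p\,dx-\int_{\mathbb R^N}G(x,u)\,dx,$$ $$\langle d\mathcal J(u),v\rangle=\int_{\mathbb R^N}A(x,u)|\nabla u|^{p-2}\nabla u\cdot\nabla v\,dx+\frac1p\int_{\mathbb R^N}A_t(x,u)v|\nabla u|^p\,dx+\int_{\mathbb R^N}V|u|^{p-2}uv\,dx-\int_{\mathbb R^N}g(x,u)v\,dx.$$ **Critical points.** Let $\varrho,\alpha^*>0$ be such that $\mathcal J(u)\ge\alpha^*$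 for all $u\in X$ with $\|u\|_V=\varrho$, let $u^*\in X$ have support contained in $B_1$ and satisfy $\|u^*\|_V>\varrho$ and $\mathcal J(u^*)<\alpha^*$, and let $\alpha^{**}=\max_{s\in[0,1]}\mathcal J(su^*)$. Let $(u_k)_{k\ge1}$ be any sequence such that, for every $k\ge1$, 1. $u_k\in X_{B_k}$, 2. $\alpha^*\le\mathcal J(u_k)\le\alpha^{**}$, 3. $\langle d\mathcal J(u_k),v\rangle=0$ for all $v\in X_{B_k}$. **Proposition.** Under these assumptions there is a constant $M_0>0$ such that $u_k\in X$ and $\|u_k\|_X\le M_0$ for all $k\ge1$. Moreover, with the same $M_0$, for every real $r\ge p$ and all $k\ge1$, $u_k\in L^r_V(\mathbb R^N)$ and $|u_k|_{V,r}\le M_0$. -/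

import Mathlib

open MeasureTheory Set Filter Topology
open scoped ENNReal ContDiff

noncomputable section

namespace QuasilinearSchrodinger

/-- The Euclidean space `ℝ^N`. -/
abbrev E (N : ℕ) : Type := EuclideanSpace ℝ (Fin N)

variable {N : ℕ}

/-! ### Weak gradients and Sobolev spaces

Elements of the spaces below are represented by functions `ℝ^N → ℝ`; all notions only depend on the
almost everywhere class. -/

/-- `w` is a weak gradient of `u` on `ℝ^N`: both are locally integrable and
`∫ u ∂ᵢφ = - ∫ wᵢ φ` for every `i` and every test function `φ ∈ C_c^∞(ℝ^N)`. -/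
def HasWeakGradient (u : E N → ℝ) (w : E N → E N) : Prop :=
  LocallyIntegrable u ∧ LocallyIntegrable w ∧
    ∀ φ : E N → ℝ, ContDiff ℝ ∞ φ → HasCompactSupport φ → ∀ i : Fin N,
      ∫ x, u x * fderiv ℝ φ x (EuclideanSpace.single i 1) = - ∫ x, w x i * φ x

open Classical in
/-- The weak gradient `∇u` (a representative of it; the weak gradient is unique up to null sets).
It is only ever used for functions that possess one. -/
def weakGrad (u : E N → ℝ) : E N → E N :=
  if h : ∃ w, HasWeakGradient u w then h.choose else 0

/-- `u ∈ W^{1,p}(ℝ^N)`. -/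
def MemW (p : ℝ) (u : E N → ℝ) : Prop :=
  MemLp u (ENNReal.ofReal p) volume ∧
    ∃ w : E N → E N, HasWeakGradient u w ∧ MemLp w (ENNReal.ofReal p) volume

/-- `u ∈ W_0^{1,p}(Ω)`, where a function on `Ω` is identified with its extension by `0` to `ℝ^N`:
`u` is a limit in `W^{1,p}` of smooth functions with compact support in `Ω`.
In particular `u = 0` almost everywhere outside `Ω`. -/
def MemWZero (p : ℝ) (Ω : Set (E N)) (u : E N → ℝ) : Prop :=
  MemW p u ∧ ∃ φ : ℕ → E N → ℝ,
    (∀ n, ContDiff ℝ ∞ (φ n) ∧ HasCompactSupport (φ n) ∧ tsupport (φ n) ⊆ Ω) ∧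
    Tendsto (fun n => eLpNorm (fun x => u x - φ n x) (ENNReal.ofReal p) volume) atTop (𝓝 0) ∧
    Tendsto (fun n => eLpNorm (fun x => weakGrad u x - gradient (φ n) x) (ENNReal.ofReal p) volume)
      atTop (𝓝 0)

/-- `u ∈ L_V^r(ℝ^N)`. -/
def MemLV (V : E N → ℝ) (r : ℝ) (u : E N → ℝ) : Prop :=
  MemLp u (ENNReal.ofReal r) volume ∧ Integrable (fun x => V x * |u x| ^ r) volume

/-- `|u|_{V,r} = (∫ V |u|^r)^{1/r}`. -/
def normLV (V : E N → ℝ) (r : ℝ) (u : E N → ℝ) : ℝ :=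
  (∫ x, V x * |u x| ^ r) ^ (1 / r)

/-- `u ∈ W_V^{1,p}(ℝ^N)`. -/
def MemWV (V : E N → ℝ) (p : ℝ) (u : E N → ℝ) : Prop :=
  MemW p u ∧ Integrable (fun x => V x * |u x| ^ p) volume

/-- `‖u‖_V = (∫ |∇u|^p + ∫ V |u|^p)^{1/p}`. -/
def normV (V : E N → ℝ) (p : ℝ) (u : E N → ℝ) : ℝ :=
  ((∫ x, ‖weakGrad u x‖ ^ p) + ∫ x, V x * |u x| ^ p) ^ (1 / p)

/-- `|u|_r`, the usual norm of `L^r(ℝ^N)`, for `1 ≤ r < ∞`. -/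
def normL (r : ℝ) (u : E N → ℝ) : ℝ := (∫ x, |u x| ^ r) ^ (1 / r)

/-- `|u|_∞`, the essential supremum of `|u|`. -/
def normLinf (u : E N → ℝ) : ℝ := (eLpNorm u ∞ volume).toReal

/-- `u ∈ X = W_V^{1,p}(ℝ^N) ∩ L^∞(ℝ^N)`. -/
def MemX (V : E N → ℝ) (p : ℝ) (u : E N → ℝ) : Prop :=
  MemWV V p u ∧ MemLp u ∞ volume

/-- `‖u‖_X = ‖u‖_V + |u|_∞`. -/
def normX (V : E N → ℝ) (p : ℝ) (u : E N → ℝ) : ℝ := normV V p u + normLinf u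

/-- `u ∈ X_Ω = W_{0,V}^{1,p}(Ω) ∩ L^∞(Ω)`, functions on `Ω` being extended by `0` to `ℝ^N`. -/
def MemXZero (V : E N → ℝ) (p : ℝ) (Ω : Set (E N)) (u : E N → ℝ) : Prop :=
  MemWZero p Ω u ∧ Integrable (fun x => V x * |u x| ^ p) volume ∧ MemLp u ∞ volume

/-! ### The functional -/

/-- The partial derivative `A_t(x,t) = ∂A/∂t (x,t)`. -/
def partialT (A : E N → ℝ → ℝ) (x : E N) (t : ℝ) : ℝ := deriv (A x) t

/-- `G(x,t) = ∫_0^t g(x,s) ds`. -/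
def primitive (g : E N → ℝ → ℝ) (x : E N) (t : ℝ) : ℝ := ∫ s in (0 : ℝ)..t, g x s

/-- `J(u) = (1/p) ∫ A(x,u)|∇u|^p + (1/p) ∫ V|u|^p - ∫ G(x,u)`. -/
def J (p : ℝ) (A : E N → ℝ → ℝ) (V : E N → ℝ) (g : E N → ℝ → ℝ) (u : E N → ℝ) : ℝ :=
  (1 / p) * (∫ x, A x (u x) * ‖weakGrad u x‖ ^ p)
    + (1 / p) * (∫ x, V x * |u x| ^ p)
    - ∫ x, primitive g x (u x)

/-- `⟨dJ(u), v⟩ = ∫ A(x,u)|∇u|^{p-2} ∇u·∇v + (1/p) ∫ A_t(x,u) v |∇u|^p + ∫ V|u|^{p-2} u v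
- ∫ g(x,u) v`. -/
def dJ (p : ℝ) (A : E N → ℝ → ℝ) (V : E N → ℝ) (g : E N → ℝ → ℝ) (u v : E N → ℝ) : ℝ :=
  (∫ x, A x (u x) * ‖weakGrad u x‖ ^ (p - 2) * inner ℝ (weakGrad u x) (weakGrad v x))
    + (1 / p) * (∫ x, partialT A x (u x) * v x * ‖weakGrad u x‖ ^ p)
    + (∫ x, V x * |u x| ^ (p - 2) * u x * v x)
    - ∫ x, g x (u x) * v x

/-! ### Assumptions on the data -/

/-- `h` is a `C^k`-Carathéodory function. -/
def IsCaratheodory (k : ℕ) (h : E N → ℝ → ℝ) : Prop :=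
  (∀ t : ℝ, AEMeasurable (fun x => h x t) volume) ∧ ∀ᵐ x : E N, ContDiff ℝ k (h x)

/-- The potential has positive essential infimum. -/
def HypV1 (V : E N → ℝ) : Prop := ∃ c > 0, ∀ᵐ x : E N, c ≤ V x

/-- `∫_{B_1(x)} 1/V → 0` as `|x| → ∞`. -/
def HypV2 (V : E N → ℝ) : Prop :=
  Tendsto (fun x : E N => ∫ y in Metric.ball x 1, 1 / V y) (cocompact (E N)) (𝓝 0)

/-- The potential is essentially bounded on bounded sets. -/
def HypV3 (V : E N → ℝ) : Prop :=
  ∀ ρ > 0, ∃ C > 0, ∀ᵐ x : E N, ‖x‖ ≤ ρ → V x ≤ C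

/-- `sup_{|t| ≤ ρ} |A(·,t)|` and `sup_{|t| ≤ ρ} |A_t(·,t)|` are in `L^∞` for each `ρ > 0`. -/
def HypH1 (A : E N → ℝ → ℝ) : Prop :=
  ∀ ρ > 0, ∃ C : ℝ, ∀ᵐ x : E N, ∀ t : ℝ, |t| ≤ ρ → |A x t| ≤ C ∧ |partialT A x t| ≤ C

/-- `A(x,t) ≥ α₀` with `α₀ > 0`. -/
def HypH2 (α₀ : ℝ) (A : E N → ℝ → ℝ) : Prop :=
  0 < α₀ ∧ ∀ᵐ x : E N, ∀ t : ℝ, α₀ ≤ A x t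

/-- `(μ - p) A(x,t) - A_t(x,t) t ≥ α₁ A(x,t)` with `μ > p`, for some `α₁ > 0`. -/
def HypH3 (p μ : ℝ) (A : E N → ℝ → ℝ) : Prop :=
  p < μ ∧ ∃ α₁ > 0, ∀ᵐ x : E N, ∀ t : ℝ, α₁ * A x t ≤ (μ - p) * A x t - partialT A x t * t

/-- `p A(x,t) + A_t(x,t) t ≥ α₂ A(x,t)` for some `α₂ > 0`. -/
def HypH4 (p : ℝ) (A : E N → ℝ → ℝ) : Prop :=
  ∃ α₂ > 0, ∀ᵐ x : E N, ∀ t : ℝ, α₂ * A x t ≤ p * A x t + partialT A x t * t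

/-- `|g(x,t)| ≤ a₁|t|^{p-1} + a₂|t|^{q-1}` with `q ≥ p`, for some `a₁, a₂ > 0`. -/
def HypG1 (p q : ℝ) (g : E N → ℝ → ℝ) : Prop :=
  p ≤ q ∧ ∃ a₁ > 0, ∃ a₂ > 0, ∀ᵐ x : E N, ∀ t : ℝ,
    |g x t| ≤ a₁ * |t| ^ (p - 1) + a₂ * |t| ^ (q - 1)

/-- `τ > 0` is a constant for the embedding `W_V^{1,p}(ℝ^N) ↪ L^p(ℝ^N)`. -/
def IsEmbeddingConst (V : E N → ℝ) (p τ : ℝ) : Prop :=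
  0 < τ ∧ ∀ u : E N → ℝ, MemWV V p u → normL p u ≤ τ * normV V p u

/-- `g(x,t)/(|t|^{p-2}t) → ᾱ` as `t → 0`, uniformly for a.e. `x`, for some real `ᾱ < α₀/τ^p`. -/
def HypG2 (p α₀ τ : ℝ) (g : E N → ℝ → ℝ) : Prop :=
  ∃ αbar : ℝ, αbar < α₀ / τ ^ p ∧ ∀ ε > 0, ∃ δ > 0, ∀ᵐ x : E N, ∀ t : ℝ, 0 < |t| → |t| < δ →
    |g x t / (|t| ^ (p - 2) * t) - αbar| < ε

/-- `0 < μ G(x,t) ≤ g(x,t) t` for `t ≠ 0`. -/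
def HypG3 (μ : ℝ) (g : E N → ℝ → ℝ) : Prop :=
  ∀ᵐ x : E N, ∀ t : ℝ, t ≠ 0 → 0 < μ * primitive g x t ∧ μ * primitive g x t ≤ g x t * t

/-- The critical Sobolev exponent `p^*`, equal to `Np/(N-p)` if `p < N` and `+∞` otherwise. -/
def criticalExponent (N : ℕ) (p : ℝ) : EReal :=
  if p < N then ((N * p / (N - p) : ℝ) : EReal) else ⊤

/-! ### Mountain pass geometry and the sequence of critical points -/

/-- `ϱ, α^* > 0` and `J(u) ≥ α^*` whenever `u ∈ X`, `‖u‖_V = ϱ`;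
moreover `u^* ∈ X` has support in `B_1`, `‖u^*‖_V > ϱ` and `J(u^*) < α^*`. -/
structure MountainPassGeometry (p : ℝ) (A : E N → ℝ → ℝ) (V : E N → ℝ) (g : E N → ℝ → ℝ)
    (ϱ αlow : ℝ) (ustar : E N → ℝ) : Prop where
  radius_pos : 0 < ϱ
  level_pos : 0 < αlow
  sphere : ∀ u : E N → ℝ, MemX V p u → normV V p u = ϱ → αlow ≤ J p A V g u
  mem : MemX V p ustar
  support : tsupport ustar ⊆ Metric.ball 0 1
  norm_gt : ϱ < normV V p ustar
  value_lt : J p A V g ustar < αlow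

/-- `(u_k)_{k ≥ 1}`: `u_k ∈ X_{B_k}` is a critical point of the restriction of `J` to `X_{B_k}`
with level between `αlow` and `αup`. The term of index `0` plays no role. -/
structure IsMountainPassSequence (p : ℝ) (A : E N → ℝ → ℝ) (V : E N → ℝ) (g : E N → ℝ → ℝ)
    (αlow αup : ℝ) (u : ℕ → E N → ℝ) : Prop where
  mem : ∀ k : ℕ, 1 ≤ k → MemXZero V p (Metric.ball 0 k) (u k)
  level_ge : ∀ k : ℕ, 1 ≤ k → αlow ≤ J p A V g (u k)
  level_le : ∀ k : ℕ, 1 ≤ k → J p A V g (u k) ≤ αup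
  critical : ∀ k : ℕ, 1 ≤ k → ∀ v : E N → ℝ, MemXZero V p (Metric.ball 0 k) v →
    dJ p A V g (u k) v = 0

end QuasilinearSchrodinger

end

/-! Write `M r = ∫ |u|^r` for a critical point `u = u_k`. In `μ J(u) - ⟨dJ(u), u⟩` the gradient
terms dominate `α₁ α₀ / p ∫ |∇u|^p`, the potential contributes `(μ - p) / p ∫ V|u|^p`, and `g u - μ
G` is nonnegative. Since `J(u) ≤ αup`, both energy integrals are bounded independently of `k`
(`energy_le_of_critical`), and `V ≥ c > 0` then bounds `M p`.

The sup bound is a Moser iteration. Testing with a smoothing of `|u|^s u`, admissible because each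
`u_k` is bounded, bounds `∫ |u|^s |∇u|^p` by `K (M (p+s) + M (q+s))` (`power_energy_le`). The `L¹`
Gagliardo–Nirenberg–Sobolev inequality for `|u|^β`, followed by Hölder, turns this into an estimate
of `M ((p+s)χ)` with `χ = N/(N-1)` (`MemWZero.rpow_integral_le`). Its constant does not depend on
the ball `B_k`. Using the `L¹` inequality treats `p < N` and `p ≥ N` alike.

From there only real numbers matter (`MomentInequalities`). The bound on `∫ |∇u|^p` controls one
moment, of critical order `p^*` if `p < N` (`exists_bound_of_sobolev`). Subcriticality of `q` lets
interpolation absorb the term `M (q+s)`, which controls a moment of as high an order as needed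
(`exists_bound_of_energy`). Above a threshold order the loss `q - p` at each step is harmless, and
iterating gives `M (r_n) ≤ exp (a χ^n)` with `r_n ≥ δ χ^n` (`exists_exp_bound`). Chebyshev's
inequality converts this into `|u| ≤ exp (max a 0 / δ)` (`ae_abs_le_of_moment_bounds`).

All constants depend on the data and on `αup` only. The weighted norms follow from `V|u|^r ≤ Λ^(r-p)
V|u|^p`, and the power `1/r` makes the bound uniform in `r` (`MemXZero.memLV`). -/

noncomputable section

namespace QuasilinearSchrodinger

variable {N : ℕ}

/-! ### Weak gradients -/

/-- Convergence in `L^P` implies convergence of the integrals against a fixed bounded function with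
compact support. -/
theorem tendsto_integral_mul_of_tendsto_eLpNorm {P : ℝ≥0∞} (hP : 1 ≤ P) {f : E N → ℝ}
    {F : ℕ → E N → ℝ} (hf : MemLp f P) (hF : ∀ n, MemLp (F n) P)
    (h : Tendsto (fun n => eLpNorm (fun x => f x - F n x) P) atTop (𝓝 0))
    {ψ : E N → ℝ} (hψ : Continuous ψ) (hψc : HasCompactSupport ψ) :
    Tendsto (fun n => ∫ x, F n x * ψ x) atTop (𝓝 (∫ x, f x * ψ x)) := by
  have : ENNReal.HolderConjugate P (ENNReal.conjExponent P) :=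
    ENNReal.HolderConjugate.conjExponent hP
  have : ENNReal.HolderConjugate (ENNReal.conjExponent P) P :=
    ENNReal.HolderTriple.symm
  have hψm : MemLp ψ (ENNReal.conjExponent P) volume := hψ.memLp_of_hasCompactSupport hψc
  refine tendsto_integral_of_L1' _ (hf.1.mul hψm.1)
    (Eventually.of_forall fun n => (hF n).integrable_mul hψm) ?_
  have hb : ∀ n, eLpNorm ((fun x => F n x * ψ x) - fun x => f x * ψ x) 1 volume
      ≤ eLpNorm ψ (ENNReal.conjExponent P) volume * eLpNorm (fun x => f x - F n x) P := by
    intro n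
    have := eLpNorm_smul_le_mul_eLpNorm (p := ENNReal.conjExponent P) (q := P) (r := 1)
      (hf.1.sub (hF n).1) hψm.1
    refine le_trans (le_of_eq ?_) this
    rw [← eLpNorm_neg]
    congr 1
    ext x
    simp only [Pi.neg_apply, Pi.sub_apply, Pi.smul_apply', smul_eq_mul]
    ring
  have h0 := ENNReal.Tendsto.const_mul h (Or.inr (hψm.2.ne))
  rw [mul_zero] at h0
  exact tendsto_of_tendsto_of_tendsto_of_le_of_le tendsto_const_nhds h0
    (fun _ => zero_le) hb

theorem locallyIntegrable_coord {w : E N → E N} (hw : LocallyIntegrable w) (i : Fin N) :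
    LocallyIntegrable (fun x => w x i) := by
  intro x
  obtain ⟨s, hs, h⟩ := hw x
  refine ⟨s, hs, ?_⟩
  exact (EuclideanSpace.proj (𝕜 := ℝ) i).integrable_comp h

theorem HasWeakGradient.ae_eq {u : E N → ℝ} {w w' : E N → E N} (h : HasWeakGradient u w)
    (h' : HasWeakGradient u w') : w =ᵐ[volume] w' := by
  have key : ∀ i : Fin N, ∀ᵐ x : E N, w x i = w' x i := by
    intro i
    refine ae_eq_of_integral_contDiff_smul_eq (locallyIntegrable_coord h.2.1 i)
      (locallyIntegrable_coord h'.2.1 i) ?_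
    intro φ hφ hc
    have h1 := h.2.2 φ hφ hc i
    have h2 := h'.2.2 φ hφ hc i
    rw [h1, neg_inj] at h2
    simpa only [smul_eq_mul, mul_comm] using h2
  filter_upwards [ae_all_iff.2 key] with x hx
  ext i
  exact hx i

/-- Since `weakGrad` is an arbitrary choice, it is always computed by exhibiting some weak gradient
and invoking uniqueness. -/
theorem HasWeakGradient.weakGrad_ae_eq {u : E N → ℝ} {w : E N → E N} (h : HasWeakGradient u w) :
    weakGrad u =ᵐ[volume] w := by
  have hex : ∃ w, HasWeakGradient u w := ⟨w, h⟩
  rw [weakGrad, dif_pos hex]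
  exact hex.choose_spec.ae_eq h

theorem MemW.memLp_weakGrad {p : ℝ} {u : E N → ℝ} (h : MemW p u) :
    MemLp (weakGrad u) (ENNReal.ofReal p) volume := by
  obtain ⟨w, hw, hm⟩ := h.2
  exact hm.ae_eq hw.weakGrad_ae_eq.symm

theorem gradient_apply_eq (φ : E N → ℝ) (x : E N) (i : Fin N) :
    gradient φ x i = fderiv ℝ φ x (EuclideanSpace.single i 1) := by
  have h : inner ℝ (gradient φ x) (EuclideanSpace.single i (1 : ℝ))
      = fderiv ℝ φ x (EuclideanSpace.single i 1) := by
    rw [gradient, InnerProductSpace.toDual_symm_apply]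
  rw [← h, EuclideanSpace.inner_single_right]
  simp

theorem norm_gradient_eq (φ : E N → ℝ) (x : E N) : ‖gradient φ x‖ = ‖fderiv ℝ φ x‖ := by
  rw [gradient, LinearIsometryEquiv.norm_map]

theorem continuous_gradient {φ : E N → ℝ} (hφ : ContDiff ℝ 1 φ) : Continuous (gradient φ) :=
  (InnerProductSpace.toDual ℝ (E N)).symm.continuous.comp (hφ.continuous_fderiv one_ne_zero)

theorem hasCompactSupport_gradient {φ : E N → ℝ} (hc : HasCompactSupport φ) :
    HasCompactSupport (gradient φ) :=
  (hc.fderiv ℝ).comp_left (g := (InnerProductSpace.toDual ℝ (E N)).symm) (map_zero _)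

theorem hasWeakGradient_gradient {φ : E N → ℝ} (hφ : ContDiff ℝ 1 φ) (hc : HasCompactSupport φ) :
    HasWeakGradient φ (gradient φ) := by
  refine ⟨hφ.continuous.locallyIntegrable, (continuous_gradient hφ).locallyIntegrable, ?_⟩
  intro ψ hψ hψc i
  simp only [gradient_apply_eq]
  have hd : Continuous fun x => fderiv ℝ φ x (EuclideanSpace.single i 1) :=
    (hφ.continuous_fderiv one_ne_zero).clm_apply continuous_const
  have hd' : Continuous fun x => fderiv ℝ ψ x (EuclideanSpace.single i 1) :=
    (hψ.continuous_fderiv (by simp)).clm_apply continuous_const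
  refine integral_mul_fderiv_eq_neg_fderiv_mul_of_integrable ?_ ?_ ?_ ?_ ?_
  · exact (hd.mul hψ.continuous).integrable_of_hasCompactSupport hψc.mul_left
  · exact (hφ.continuous.mul hd').integrable_of_hasCompactSupport hc.mul_right
  · exact (hφ.continuous.mul hψ.continuous).integrable_of_hasCompactSupport hc.mul_right
  · exact fun x _ => (hφ.differentiable (by simp)) x
  · exact fun x _ => (hψ.differentiable (by simp)) x

theorem memLp_of_contDiff {φ : E N → ℝ} (hφ : ContDiff ℝ 1 φ) (hc : HasCompactSupport φ)
    (P : ℝ≥0∞) : MemLp φ P volume :=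
  hφ.continuous.memLp_of_hasCompactSupport hc

theorem memLp_gradient {φ : E N → ℝ} (hφ : ContDiff ℝ 1 φ) (hc : HasCompactSupport φ)
    (P : ℝ≥0∞) : MemLp (gradient φ) P volume :=
  (continuous_gradient hφ).memLp_of_hasCompactSupport (hasCompactSupport_gradient hc)

/-- Weak gradients are stable under `L^P` limits. -/
theorem hasWeakGradient_of_tendsto {P : ℝ≥0∞} (hP : 1 ≤ P) {u : E N → ℝ} {w : E N → E N}
    {φ : ℕ → E N → ℝ} {v : ℕ → E N → E N} (hu : MemLp u P) (hw : MemLp w P)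
    (hφ : ∀ n, MemLp (φ n) P) (hv : ∀ n, MemLp (v n) P) (h : ∀ n, HasWeakGradient (φ n) (v n))
    (h1 : Tendsto (fun n => eLpNorm (fun x => u x - φ n x) P) atTop (𝓝 0))
    (h2 : Tendsto (fun n => eLpNorm (fun x => w x - v n x) P) atTop (𝓝 0)) :
    HasWeakGradient u w := by
  refine ⟨hu.locallyIntegrable hP, hw.locallyIntegrable hP, ?_⟩
  intro ψ hψ hψc i
  have hd' : Continuous fun x => fderiv ℝ ψ x (EuclideanSpace.single i 1) :=
    (hψ.continuous_fderiv (by simp)).clm_apply continuous_const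
  have hc' : HasCompactSupport fun x => fderiv ℝ ψ x (EuclideanSpace.single i 1) :=
    hψc.fderiv_apply ℝ _
  have l1 := tendsto_integral_mul_of_tendsto_eLpNorm hP hu hφ h1 hd' hc'
  have hcoord : ∀ {f : E N → E N}, MemLp f P → MemLp (fun x => f x i) P := by
    intro f hf
    exact (EuclideanSpace.proj (𝕜 := ℝ) i).comp_memLp' hf
  have h2' : Tendsto (fun n => eLpNorm (fun x => w x i - v n x i) P) atTop (𝓝 0) := by
    refine tendsto_of_tendsto_of_tendsto_of_le_of_le tendsto_const_nhds h2
      (fun _ => zero_le) (fun n => ?_)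
    refine eLpNorm_mono fun x => ?_
    exact PiLp.norm_apply_le (w x - v n x) i
  have l2 := (tendsto_integral_mul_of_tendsto_eLpNorm hP (hcoord hw) (fun n => hcoord (hv n)) h2'
    hψ.continuous hψc).neg
  refine tendsto_nhds_unique l1 (l2.congr fun n => ?_)
  exact ((h n).2.2 ψ hψ hψc i).symm

/-! ### The chain rule and the Gagliardo–Nirenberg–Sobolev inequality in `W_0^{1,p}` -/

/-- Convergence in `L^p` implies convergence in measure, hence a.e. along a subsequence. The a.e.
limit is needed for dominated convergence in the chain rule and for Fatou's lemma in the Sobolev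
inequality. -/
theorem MemWZero.exists_ae_approximation {p : ℝ} (hp : 1 ≤ p) {Ω : Set (E N)} {u : E N → ℝ}
    (hu : MemWZero p Ω u) : ∃ φ : ℕ → E N → ℝ,
      (∀ n, ContDiff ℝ ∞ (φ n) ∧ HasCompactSupport (φ n) ∧ tsupport (φ n) ⊆ Ω) ∧
      Tendsto (fun n => eLpNorm (fun x => u x - φ n x) (ENNReal.ofReal p) volume) atTop (𝓝 0) ∧
      Tendsto (fun n => eLpNorm (fun x => weakGrad u x - gradient (φ n) x) (ENNReal.ofReal p)
        volume) atTop (𝓝 0) ∧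
      ∀ᵐ x, Tendsto (fun n => φ n x) atTop (𝓝 (u x)) := by
  obtain ⟨hW, φ, hφ, h1, h2⟩ := hu
  have hm : TendstoInMeasure volume φ atTop u := by
    refine tendstoInMeasure_of_tendsto_eLpNorm (p := ENNReal.ofReal p)
      (by simpa using (by linarith : (0 : ℝ) < p))
      (fun n => (hφ n).1.continuous.aestronglyMeasurable) hW.1.1 ?_
    refine h1.congr fun n => ?_
    rw [← eLpNorm_neg]
    congr 1
    ext x
    simp
  obtain ⟨ns, hns, hae⟩ := hm.exists_seq_tendsto_ae
  exact ⟨fun n => φ (ns n), fun n => hφ _, h1.comp hns.tendsto_atTop, h2.comp hns.tendsto_atTop,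
    hae⟩

theorem tendsto_eLpNorm_smul_of_tendsto_ae {P : ℝ≥0∞} (hP0 : P ≠ 0) (hPt : P ≠ ⊤) {w : E N → E N}
    (hw : MemLp w P) {f : ℕ → E N → ℝ} (hf : ∀ n, AEStronglyMeasurable (f n) volume) {C : ℝ}
    (hC : ∀ n x, |f n x| ≤ C) (hlim : ∀ᵐ x, Tendsto (fun n => f n x) atTop (𝓝 0)) :
    Tendsto (fun n => eLpNorm (fun x => f n x • w x) P volume) atTop (𝓝 0) := by
  have hr : 0 < P.toReal := ENNReal.toReal_pos hP0 hPt
  simp only [eLpNorm_eq_lintegral_rpow_enorm_toReal hP0 hPt]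
  have h0 : Tendsto (fun n => ∫⁻ x, ‖f n x • w x‖ₑ ^ P.toReal) atTop (𝓝 (∫⁻ _x : E N, 0)) := by
    refine tendsto_lintegral_of_dominated_convergence'
      (fun x => (ENNReal.ofReal C * ‖w x‖ₑ) ^ P.toReal) ?_ ?_ ?_ ?_
    · exact fun n => ((hf n).smul hw.1).enorm.pow_const _
    · intro n
      refine Eventually.of_forall fun x => ?_
      refine ENNReal.rpow_le_rpow ?_ hr.le
      rw [enorm_smul]
      gcongr
      rw [← ofReal_norm]
      exact ENNReal.ofReal_le_ofReal (hC n x)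
    · have h1 : MemLp (fun x => C • w x) P := hw.const_smul C
      have h2 := (lintegral_rpow_enorm_lt_top_of_eLpNorm_lt_top hP0 hPt hw.2).ne
      simp_rw [ENNReal.mul_rpow_of_nonneg _ _ hr.le]
      rw [lintegral_const_mul' _ _ (by finiteness)]
      exact ENNReal.mul_ne_top (by finiteness) h2
    · filter_upwards [hlim] with x hx
      have h1 : Tendsto (fun n => ‖f n x • w x‖ₑ) atTop (𝓝 0) := by
        have := (hx.smul_const (w x)).enorm
        simpa using this
      have := (ENNReal.continuous_rpow_const (y := P.toReal)).tendsto 0 |>.comp h1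
      simpa [ENNReal.zero_rpow_of_pos hr, Function.comp_def] using this
  rw [lintegral_zero] at h0
  have := (ENNReal.continuous_rpow_const (y := 1 / P.toReal)).tendsto 0 |>.comp h0
  simpa [ENNReal.zero_rpow_of_pos (inv_pos.2 hr), Function.comp_def] using this

theorem abs_sub_le_of_abs_deriv_le {F : ℝ → ℝ} (hF : ContDiff ℝ 1 F) {B : ℝ}
    (hB : ∀ t, |deriv F t| ≤ B) (a b : ℝ) : |F a - F b| ≤ B * |a - b| := by
  have := convex_univ.norm_image_sub_le_of_norm_deriv_le (f := F) (C := B) (x := b) (y := a)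
    (fun x _ => (hF.differentiable (by simp)) x) (fun x _ => hB x) (mem_univ _) (mem_univ _)
  simpa using this

theorem gradient_comp {F : ℝ → ℝ} (hF : ContDiff ℝ 1 F) {φ : E N → ℝ} (hφ : ContDiff ℝ 1 φ)
    (x : E N) : gradient (fun y => F (φ y)) x = deriv F (φ x) • gradient φ x := by
  have h1 : HasDerivAt F (deriv F (φ x)) (φ x) :=
    ((hF.differentiable (by simp)) _).hasDerivAt
  have h2 : HasFDerivAt φ (fderiv ℝ φ x) x := ((hφ.differentiable (by simp)) x).hasFDerivAt
  have h3 := (h1.comp_hasFDerivAt x h2).fderiv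
  rw [gradient, gradient, ← map_smul]
  congr 1

section chain

variable {p : ℝ} {Ω : Set (E N)} {u : E N → ℝ} {φ : ℕ → E N → ℝ} {F : ℝ → ℝ} {B : ℝ}

theorem tendsto_eLpNorm_comp (hF : ContDiff ℝ 1 F) (hB : ∀ t, |deriv F t| ≤ B)
    (h1 : Tendsto (fun n => eLpNorm (fun x => u x - φ n x) (ENNReal.ofReal p) volume) atTop (𝓝 0)) :
    Tendsto (fun n => eLpNorm (fun x => F (u x) - F (φ n x)) (ENNReal.ofReal p) volume)
      atTop (𝓝 0) := by
  have h0 := ENNReal.Tendsto.const_mul (a := ENNReal.ofReal B) h1 (Or.inr (by finiteness))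
  rw [mul_zero] at h0
  refine tendsto_of_tendsto_of_tendsto_of_le_of_le tendsto_const_nhds h0
    (fun _ => zero_le) (fun n => ?_)
  exact eLpNorm_le_mul_eLpNorm_of_ae_le_mul
    (Eventually.of_forall fun x => abs_sub_le_of_abs_deriv_le hF hB _ _) _

/-- Split the difference as `(F'(u) - F'(φ_n)) ∇u + F'(φ_n) (∇u - ∇φ_n)`. The first term vanishes by
dominated convergence, the second because `|F'| ≤ B`. -/
theorem tendsto_eLpNorm_gradient_comp (hp : 1 ≤ p) (hu : MemW p u) (hF : ContDiff ℝ 1 F)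
    (hB : ∀ t, |deriv F t| ≤ B) (hφ : ∀ n, ContDiff ℝ ∞ (φ n))
    (h2 : Tendsto (fun n => eLpNorm (fun x => weakGrad u x - gradient (φ n) x) (ENNReal.ofReal p)
      volume) atTop (𝓝 0))
    (h3 : ∀ᵐ x, Tendsto (fun n => φ n x) atTop (𝓝 (u x))) :
    Tendsto (fun n => eLpNorm (fun x => deriv F (u x) • weakGrad u x
      - gradient (fun y => F (φ n y)) x) (ENNReal.ofReal p) volume) atTop (𝓝 0) := by
  have hp0 : ENNReal.ofReal p ≠ 0 := by simpa using (by linarith : (0 : ℝ) < p)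
  have hP1 : 1 ≤ ENNReal.ofReal p := by simpa using hp
  have hF' : Continuous (deriv F) := hF.continuous_deriv le_rfl
  have hmu : ∀ n, AEStronglyMeasurable (fun x => deriv F (u x) - deriv F (φ n x)) volume :=
    fun n => (hF'.comp_aestronglyMeasurable hu.1.1).sub
      (hF'.comp (hφ n).continuous).aestronglyMeasurable
  have ha := tendsto_eLpNorm_smul_of_tendsto_ae hp0 ENNReal.ofReal_ne_top hu.memLp_weakGrad
    (f := fun n x => deriv F (u x) - deriv F (φ n x)) hmu (C := B + B)
    (fun n x => (abs_sub _ _).trans (add_le_add (hB _) (hB _)))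
    (by
      filter_upwards [h3] with x hx
      have := (tendsto_const_nhds (x := deriv F (u x))).sub ((hF'.tendsto (u x)).comp hx)
      simpa using this)
  have hb := ENNReal.Tendsto.const_mul (a := ENNReal.ofReal B) h2 (Or.inr (by finiteness))
  rw [mul_zero] at hb
  have hab := ha.add hb
  rw [add_zero] at hab
  refine tendsto_of_tendsto_of_tendsto_of_le_of_le tendsto_const_nhds hab
    (fun _ => zero_le) (fun n => ?_)
  have hφ1 : ContDiff ℝ 1 (φ n) := (hφ n).of_le (by exact_mod_cast le_top)
  have hgm : AEStronglyMeasurable (gradient (φ n)) volume :=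
    (continuous_gradient hφ1).aestronglyMeasurable
  have heq : (fun x => deriv F (u x) • weakGrad u x - gradient (fun y => F (φ n y)) x)
      = (fun x => (deriv F (u x) - deriv F (φ n x)) • weakGrad u x)
        + fun x => deriv F (φ n x) • (weakGrad u x - gradient (φ n) x) := by
    ext1 x
    simp only [Pi.add_apply, gradient_comp hF hφ1]
    module
  rw [heq]
  refine (eLpNorm_add_le ((hmu n).smul hu.memLp_weakGrad.1)
    ((hF'.comp (hφ n).continuous).aestronglyMeasurable.smul (hu.memLp_weakGrad.1.sub hgm))
    hP1).trans ?_
  refine add_le_add le_rfl ?_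
  refine eLpNorm_le_mul_eLpNorm_of_ae_le_mul (Eventually.of_forall fun x => ?_) _
  rw [Pi.smul_apply', norm_smul]
  exact mul_le_mul_of_nonneg_right (hB _) (norm_nonneg _)

theorem memLp_comp (hF : ContDiff ℝ 1 F) (hF0 : F 0 = 0)
    (hB : ∀ t, |deriv F t| ≤ B) {P : ℝ≥0∞} (hu : MemLp u P) : MemLp (fun x => F (u x)) P :=
  hu.of_le_mul (c := B) (hF.continuous.comp_aestronglyMeasurable hu.1)
    (Eventually.of_forall fun x => by
      simpa [hF0] using abs_sub_le_of_abs_deriv_le hF hB (u x) 0)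

theorem memLp_deriv_smul_weakGrad (hu : MemW p u) (hF : ContDiff ℝ 1 F)
    (hB : ∀ t, |deriv F t| ≤ B) :
    MemLp (fun x => deriv F (u x) • weakGrad u x) (ENNReal.ofReal p) :=
  hu.memLp_weakGrad.of_le_mul (c := B)
    (((hF.continuous_deriv le_rfl).comp_aestronglyMeasurable hu.1.1).smul hu.memLp_weakGrad.1)
    (Eventually.of_forall fun x => by
      rw [norm_smul]
      exact mul_le_mul_of_nonneg_right (hB _) (norm_nonneg _))

theorem hasCompactSupport_comp_of_zero (hF0 : F 0 = 0) {ψ : E N → ℝ} (hψ : HasCompactSupport ψ) :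
    HasCompactSupport fun x => F (ψ x) :=
  hψ.comp_left (g := F) hF0

theorem tsupport_comp_subset_of_zero (hF0 : F 0 = 0) (ψ : E N → ℝ) :
    tsupport (fun x => F (ψ x)) ⊆ tsupport ψ := by
  refine closure_mono fun x hx => ?_
  contrapose! hx
  simp only [Function.mem_support, not_not] at hx ⊢
  rw [hx, hF0]

/-- The chain rule in `W_0^{1,p}(Ω)` for smooth functions with bounded derivative. -/
theorem MemWZero.comp (hp : 1 ≤ p) (hu : MemWZero p Ω u) (hF : ContDiff ℝ ∞ F) (hF0 : F 0 = 0)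
    (hB : ∀ t, |deriv F t| ≤ B) :
    MemWZero p Ω (fun x => F (u x)) ∧
      weakGrad (fun x => F (u x)) =ᵐ[volume] fun x => deriv F (u x) • weakGrad u x := by
  have hP1 : 1 ≤ ENNReal.ofReal p := by simpa using hp
  have hF1 : ContDiff ℝ 1 F := hF.of_le (by exact_mod_cast le_top)
  obtain ⟨φ, hφ, h1, h2, h3⟩ := hu.exists_ae_approximation hp
  have hW := hu.1
  have hφ1 : ∀ n, ContDiff ℝ 1 (fun x => F (φ n x)) :=
    fun n => hF1.comp ((hφ n).1.of_le (by exact_mod_cast le_top))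
  have hc : ∀ n, HasCompactSupport fun x => F (φ n x) :=
    fun n => hasCompactSupport_comp_of_zero hF0 (hφ n).2.1
  have l1 := tendsto_eLpNorm_comp hF1 hB h1
  have l2 := tendsto_eLpNorm_gradient_comp hp hW hF1 hB (fun n => (hφ n).1) h2 h3
  have m1 : MemLp (fun x => F (u x)) (ENNReal.ofReal p) := memLp_comp hF1 hF0 hB hW.1
  have m2 := memLp_deriv_smul_weakGrad hW hF1 hB
  have hwg : HasWeakGradient (fun x => F (u x)) (fun x => deriv F (u x) • weakGrad u x) :=
    hasWeakGradient_of_tendsto hP1 m1 m2 (fun n => memLp_of_contDiff (hφ1 n) (hc n) _)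
      (fun n => memLp_gradient (hφ1 n) (hc n) _)
      (fun n => hasWeakGradient_gradient (hφ1 n) (hc n)) l1 l2
  have hae := hwg.weakGrad_ae_eq
  refine ⟨⟨⟨m1, _, hwg, m2⟩, fun n x => F (φ n x), fun n => ⟨hF.comp (hφ n).1, hc n,
    (tsupport_comp_subset_of_zero hF0 _).trans (hφ n).2.2⟩, l1, l2.congr fun n => ?_⟩, hae⟩
  refine eLpNorm_congr_ae ?_
  filter_upwards [hae] with x hx
  rw [hx]

/-- The approximating gradients converge in `L^p`, while the Sobolev inequality needs their `L¹`
norms. As `h` vanishes off `Ω`, the error is measured on `Ω` only, where Hölder compares the two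
norms. -/
theorem eLpNorm_one_le_add_of_support_subset (hp : 1 ≤ p) {f h : E N → E N}
    (hsupp : Function.support h ⊆ Ω) (hf : AEStronglyMeasurable f volume)
    (hh : AEStronglyMeasurable h volume) :
    eLpNorm h 1 volume ≤ eLpNorm f 1 volume
      + eLpNorm (fun x => f x - h x) (ENNReal.ofReal p) volume * volume Ω ^ (1 - 1 / p) := by
  have hP1 : 1 ≤ ENNReal.ofReal p := by simpa using hp
  have hd : AEStronglyMeasurable (fun x => f x - h x) volume := hf.sub hh
  have e2 : h = f - (fun x => f x - h x) := by
    ext1 x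
    rw [Pi.sub_apply, sub_sub_cancel]
  rw [← eLpNorm_restrict_eq_of_support_subset hsupp]
  nth_rewrite 1 [e2]
  refine (eLpNorm_sub_le hf.restrict hd.restrict le_rfl).trans ?_
  refine add_le_add (eLpNorm_mono_measure _ Measure.restrict_le_self) ?_
  have h1 := eLpNorm_le_eLpNorm_mul_rpow_measure_univ hP1 (hd.restrict (s := Ω))
  rw [Measure.restrict_apply_univ, ENNReal.toReal_one, ENNReal.toReal_ofReal (by linarith),
    div_one] at h1
  exact h1.trans (mul_le_mul' (eLpNorm_mono_measure _ Measure.restrict_le_self) le_rfl)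

/-- The Gagliardo–Nirenberg–Sobolev inequality for `F(u)`, with `u ∈ W_0^{1,p}(Ω)`. -/
theorem MemWZero.eLpNorm_comp_le (hp : 1 ≤ p) (hu : MemWZero p Ω u)
    (hΩ : volume Ω ≠ ⊤) (hF : ContDiff ℝ 1 F) (hF0 : F 0 = 0)
    (hB : ∀ t, |deriv F t| ≤ B) {χ : NNReal} (hχ : NNReal.HolderConjugate N χ) :
    eLpNorm (fun x => F (u x)) χ volume ≤
      eLpNormLESNormFDerivOneConst (volume : Measure (E N)) χ *
        eLpNorm (fun x => deriv F (u x) • weakGrad u x) 1 volume := by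
  have hP1 : 1 ≤ ENNReal.ofReal p := by simpa using hp
  obtain ⟨φ, hφ, h1, h2, h3⟩ := hu.exists_ae_approximation hp
  have hW := hu.1
  have hφ1 : ∀ n, ContDiff ℝ 1 (fun x => F (φ n x)) :=
    fun n => hF.comp ((hφ n).1.of_le (by exact_mod_cast le_top))
  have hc : ∀ n, HasCompactSupport fun x => F (φ n x) :=
    fun n => hasCompactSupport_comp_of_zero hF0 (hφ n).2.1
  have l2 := tendsto_eLpNorm_gradient_comp hp hW hF hB (fun n => (hφ n).1) h2 h3
  have m2 := memLp_deriv_smul_weakGrad hW hF hB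
  set w : E N → E N := fun x => deriv F (u x) • weakGrad u x with hw
  set D : ℝ≥0∞ := volume Ω ^ (1 - 1 / p) with hD
  have hDt : D ≠ ⊤ := by
    refine ENNReal.rpow_ne_top_of_nonneg ?_ hΩ
    rw [sub_nonneg]
    exact (div_le_one (by linarith)).2 hp
  have hn : ∀ n, eLpNorm (fun x => F (φ n x)) χ volume ≤
      eLpNormLESNormFDerivOneConst (volume : Measure (E N)) χ * (eLpNorm w 1 volume +
        eLpNorm (fun x => w x - gradient (fun y => F (φ n y)) x) (ENNReal.ofReal p) volume
          * D) := by
    intro n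
    refine (eLpNorm_le_eLpNorm_fderiv_one volume (hφ1 n) (hc n) (p := χ)
      (by simpa using hχ)).trans ?_
    gcongr
    have e1 : eLpNorm (fderiv ℝ fun x => F (φ n x)) 1 volume
        = eLpNorm (gradient fun x => F (φ n x)) 1 volume :=
      eLpNorm_congr_norm_ae (Eventually.of_forall fun x => (norm_gradient_eq _ x).symm)
    have hsupp : Function.support (gradient fun x => F (φ n x)) ⊆ Ω := by
      intro x hx
      refine (hφ n).2.2 (tsupport_comp_subset_of_zero hF0 _
        (support_fderiv_subset ℝ (f := fun x => F (φ n x)) ?_))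
      rw [Function.mem_support] at hx ⊢
      intro h0
      apply hx
      rw [gradient, h0, map_zero]
    rw [e1]
    exact eLpNorm_one_le_add_of_support_subset hp hsupp m2.1
      (memLp_gradient (hφ1 n) (hc n) 1).1
  have hlim := Lp.eLpNorm_lim_le_liminf_eLpNorm (p := (χ : ℝ≥0∞))
    (fun n => (hφ1 n).continuous.aestronglyMeasurable) (fun x => F (u x)) (μ := volume)
    (by filter_upwards [h3] with x hx using (hF.continuous.tendsto _).comp hx)
  -- The factor `D`, a power of the measure of `Ω`, multiplies an error that tends to zero. The
  -- limiting inequality therefore has a constant independent of `Ω`, which makes it uniform over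
  -- the balls `B_k`.
  have hr : Tendsto (fun n => eLpNormLESNormFDerivOneConst (volume : Measure (E N)) χ *
      (eLpNorm w 1 volume +
        eLpNorm (fun x => w x - gradient (fun y => F (φ n y)) x) (ENNReal.ofReal p) volume * D))
      atTop (𝓝 (eLpNormLESNormFDerivOneConst (volume : Measure (E N)) χ *
        (eLpNorm w 1 volume + 0 * D))) := by
    refine ENNReal.Tendsto.const_mul ?_ (Or.inr ENNReal.coe_ne_top)
    exact tendsto_const_nhds.add (ENNReal.Tendsto.mul_const l2 (Or.inr hDt))
  rw [zero_mul, add_zero] at hr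
  refine hlim.trans ?_
  rw [← hr.liminf_eq]
  exact liminf_le_liminf (Eventually.of_forall hn)

end chain

/-! ### Integrability of powers and of Carathéodory functions -/

/-- For a simple function in place of `u` the composition is a finite sum of sections cut off to
measurable sets. Continuity in `t` carries measurability to the limit. -/
theorem aemeasurable_comp_of_caratheodory {α : Type*} [MeasurableSpace α] {ν : Measure α}
    {h : α → ℝ → ℝ} (hm : ∀ t, AEMeasurable (fun x => h x t) ν)
    (hc : ∀ᵐ x ∂ν, Continuous (h x)) {u : α → ℝ} (hu : AEMeasurable u ν) :
    AEMeasurable (fun x => h x (u x)) ν := by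
  have hs : StronglyMeasurable (hu.mk u) := hu.measurable_mk.stronglyMeasurable
  have hsimple : ∀ n, AEMeasurable (fun x => h x (hs.approx n x)) ν := by
    intro n
    have he : (fun x => h x (hs.approx n x)) = ∑ c ∈ (hs.approx n).range,
        (hs.approx n ⁻¹' {c}).indicator (fun x => h x c) := by
      ext x
      rw [Finset.sum_apply, Finset.sum_eq_single (hs.approx n x)]
      · simp
      · intro b _ hb
        rw [indicator_of_notMem]
        simpa using hb.symm
      · intro hx
        exact absurd (SimpleFunc.mem_range_self _ x) hx
    rw [he]
    exact Finset.aemeasurable_sum _ fun c _ =>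
      (hm c).indicator ((hs.approx n).measurableSet_fiber c)
  have hlim : AEMeasurable (fun x => h x (hu.mk u x)) ν := by
    refine aemeasurable_of_tendsto_metrizable_ae atTop hsimple ?_
    filter_upwards [hc] with x hx
    exact (hx.tendsto _).comp (hs.tendsto_approx x)
  refine hlim.congr ?_
  filter_upwards [hu.ae_eq_mk] with x hx
  rw [hx]

theorem integrable_abs_rpow {p r m : ℝ} (hp : 0 < p) (hr : p ≤ r) {u : E N → ℝ}
    (hu : MemLp u (ENNReal.ofReal p) volume) (hm : ∀ᵐ x, |u x| ≤ m) :
    Integrable (fun x => |u x| ^ r) volume := by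
  have h1 : Integrable (fun x => |u x| ^ p) volume := by
    have := hu.integrable_norm_rpow (by simpa using hp) ENNReal.ofReal_ne_top
    simpa [ENNReal.toReal_ofReal hp.le] using this
  refine (h1.const_mul (m ^ (r - p))).mono'
    ((hu.1.norm.aemeasurable.pow_const r).aestronglyMeasurable) ?_
  filter_upwards [hm] with x hx
  rw [Real.norm_of_nonneg (by positivity)]
  have : |u x| ^ r = |u x| ^ (r - p) * |u x| ^ p := by
    rw [← Real.rpow_add_of_nonneg (abs_nonneg _) (by linarith) hp.le]
    ring_nf
  rw [this]
  gcongr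

theorem integrable_norm_rpow_of_memLp {p : ℝ} (hp : 0 < p) {w : E N → E N}
    (hw : MemLp w (ENNReal.ofReal p) volume) : Integrable (fun x => ‖w x‖ ^ p) volume := by
  have := hw.integrable_norm_rpow (by simpa using hp) ENNReal.ofReal_ne_top
  simpa [ENNReal.toReal_ofReal hp.le] using this

theorem integrable_bdd_mul {b f : E N → ℝ} (hb : AEStronglyMeasurable b volume) {C : ℝ}
    (hC : ∀ᵐ x, |b x| ≤ C) (hf : Integrable f volume) :
    Integrable (fun x => b x * f x) volume :=
  hf.bdd_mul hb hC

/-! ### The Sobolev inequality for powers -/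

/-- Take the odd primitive of `β min(|t|, m)^(β-1)`: it is `± |t|^β` on `[-m, m]` and continues with
constant slope, so its derivative is bounded as the Sobolev inequality for `F(u)` requires. -/
theorem exists_contDiff_power {β m : ℝ} (hβ : 1 < β) (hm : 0 ≤ m) : ∃ F : ℝ → ℝ, ∃ B : ℝ,
    ContDiff ℝ 1 F ∧ F 0 = 0 ∧ (∀ t, |deriv F t| ≤ B) ∧
      ∀ t, |t| ≤ m → |F t| = |t| ^ β ∧ deriv F t = β * |t| ^ (β - 1) := by
  set h : ℝ → ℝ := fun t => β * (min |t| m) ^ (β - 1) with hh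
  have hcont : Continuous h :=
    continuous_const.mul ((continuous_abs.min continuous_const).rpow_const
      fun _ => Or.inr (by linarith))
  have hd : ∀ t, HasDerivAt (fun t => ∫ σ in (0 : ℝ)..t, h σ) (h t) t := fun t =>
    intervalIntegral.integral_hasDerivAt_right (hcont.intervalIntegrable _ _)
      (hcont.stronglyMeasurableAtFilter _ _) hcont.continuousAt
  have hde : deriv (fun t => ∫ σ in (0 : ℝ)..t, h σ) = h := funext fun t => (hd t).deriv
  have hpos : ∀ t, 0 ≤ t → t ≤ m → ∫ σ in (0 : ℝ)..t, h σ = t ^ β := by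
    intro t h0 h1
    have : ∫ σ in (0 : ℝ)..t, h σ = ∫ σ in (0 : ℝ)..t, β * σ ^ (β - 1) := by
      refine intervalIntegral.integral_congr fun σ hσ => ?_
      rw [uIcc_of_le h0] at hσ
      simp only [hh]
      rw [abs_of_nonneg hσ.1, min_eq_left (hσ.2.trans h1)]
    rw [this, intervalIntegral.integral_const_mul, integral_rpow (Or.inl (by linarith))]
    rw [sub_add_cancel, Real.zero_rpow (by linarith), sub_zero]
    field_simp
  have hneg : ∀ t, ∫ σ in (0 : ℝ)..(-t), h σ = - ∫ σ in (0 : ℝ)..t, h σ := by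
    intro t
    have h1 : ∫ σ in (0 : ℝ)..t, h (-σ) = ∫ σ in (-t)..(-0), h σ :=
      intervalIntegral.integral_comp_neg h
    have h2 : ∀ σ, h (-σ) = h σ := fun σ => by simp only [hh, abs_neg]
    simp only [h2, neg_zero] at h1
    rw [h1, intervalIntegral.integral_symm]
  refine ⟨fun t => ∫ σ in (0 : ℝ)..t, h σ, β * m ^ (β - 1), ?_, by simp, ?_, ?_⟩
  · rw [contDiff_one_iff_deriv, hde]
    exact ⟨fun t => (hd t).differentiableAt, hcont⟩
  · intro t
    have h0 : 0 ≤ min |t| m := le_min (abs_nonneg _) hm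
    rw [hde, abs_of_nonneg (by positivity)]
    simp only [hh]
    gcongr
    exact min_le_right _ _
  · intro t ht
    refine ⟨?_, by rw [hde]; simp only [hh]; rw [min_eq_left ht]⟩
    have h3 : |∫ σ in (0 : ℝ)..t, h σ| = |∫ σ in (0 : ℝ)..|t|, h σ| := by
      rcases abs_cases t with ⟨h, -⟩ | ⟨h, -⟩
      · rw [h]
      · rw [h, hneg, abs_neg]
    rw [h3, hpos _ (abs_nonneg _) ht, abs_of_nonneg (by positivity)]

/-- The Sobolev inequality for powers of bounded functions in `W_0^{1,p}`. -/
theorem MemWZero.rpow_integral_le {p m : ℝ} (hp : 1 < p) {Ω : Set (E N)}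
    {u : E N → ℝ} (hu : MemWZero p Ω u) (hΩ : volume Ω ≠ ⊤) (hm : ∀ᵐ x, |u x| ≤ m)
    {χ : NNReal} (hχ : NNReal.HolderConjugate N χ) {β s Q p' : ℝ} (hβ : 1 < β) (hs : 0 ≤ s)
    (hpp : p.HolderConjugate p') (hQ : Q = (β - 1 - s / p) * p') (hQp : p ≤ Q)
    (hβp : p ≤ β * χ) :
    (∫ x, |u x| ^ (β * χ)) ^ (1 / (χ : ℝ)) ≤
      eLpNormLESNormFDerivOneConst (volume : Measure (E N)) χ * β *
        (∫ x, |u x| ^ s * ‖weakGrad u x‖ ^ p) ^ (1 / p) * (∫ x, |u x| ^ Q) ^ (1 / p') := by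
  have hp0 : 0 < p := by linarith
  have hχ0 : 0 < (χ : ℝ) := by exact_mod_cast hχ.symm.pos
  have hm0 : 0 ≤ max m 0 := le_max_right _ _
  have hm' : ∀ᵐ x, |u x| ≤ max m 0 := hm.mono fun x hx => hx.trans (le_max_left _ _)
  obtain ⟨F, B, hF, hF0, hB, hFe⟩ := exists_contDiff_power hβ hm0
  have hW := hu.1
  have hgns := hu.eLpNorm_comp_le hp.le hΩ hF hF0 hB hχ
  have i1 := integrable_abs_rpow hp0 hβp hW.1 hm
  have i2 := integrable_abs_rpow hp0 hQp hW.1 hm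
  have i3 : Integrable (fun x => |u x| ^ s * ‖weakGrad u x‖ ^ p) volume := by
    refine integrable_bdd_mul (C := (max m 0) ^ s)
      (hW.1.1.norm.aemeasurable.pow_const s).aestronglyMeasurable ?_
      (integrable_norm_rpow_of_memLp hp0 hW.memLp_weakGrad)
    filter_upwards [hm'] with x hx
    rw [abs_of_nonneg (by positivity)]
    gcongr
  set C := eLpNormLESNormFDerivOneConst (volume : Measure (E N)) χ with hC
  have e1 : eLpNorm (fun x => F (u x)) χ volume
      = ENNReal.ofReal ((∫ x, |u x| ^ (β * χ)) ^ (1 / (χ : ℝ))) := by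
    rw [eLpNorm_eq_lintegral_rpow_enorm_toReal (by simpa using hχ.symm.ne_zero)
      ENNReal.coe_ne_top, ENNReal.coe_toReal, ← ENNReal.ofReal_rpow_of_nonneg
      (integral_nonneg fun x => by positivity) (by positivity),
      ofReal_integral_eq_lintegral_ofReal i1 (Eventually.of_forall fun x => by positivity)]
    congr 1
    refine lintegral_congr_ae ?_
    filter_upwards [hm'] with x hx
    rw [← ofReal_norm, Real.norm_eq_abs, (hFe _ hx).1,
      ENNReal.ofReal_rpow_of_nonneg (by positivity) hχ0.le, ← Real.rpow_mul (abs_nonneg _)]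
  have e2 : eLpNorm (fun x => deriv F (u x) • weakGrad u x) 1 volume ≤ ENNReal.ofReal (β *
      ((∫ x, |u x| ^ s * ‖weakGrad u x‖ ^ p) ^ (1 / p) * (∫ x, |u x| ^ Q) ^ (1 / p'))) := by
    rw [eLpNorm_one_eq_lintegral_enorm, ENNReal.ofReal_mul (by linarith), ENNReal.ofReal_mul
      (by positivity), ← ENNReal.ofReal_rpow_of_nonneg (integral_nonneg fun x => by positivity)
      (by positivity), ← ENNReal.ofReal_rpow_of_nonneg (integral_nonneg fun x => by positivity)
      (one_div_nonneg.2 hpp.symm.nonneg),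
      ofReal_integral_eq_lintegral_ofReal i3 (Eventually.of_forall fun x => by positivity),
      ofReal_integral_eq_lintegral_ofReal i2 (Eventually.of_forall fun x => by positivity)]
    -- Hölder with exponents `p` and `p'` for the product of `|u|^(s/p) |∇u|` and `|u|^(Q/p')`. The
    -- value of `Q` is the one for which the powers of `|u|` multiply to `|u|^(β-1)`.
    refine le_trans (le_of_eq ?_) (mul_le_mul' le_rfl
      (ENNReal.lintegral_mul_norm_pow_le i3.1.aemeasurable.ennreal_ofReal
      i2.1.aemeasurable.ennreal_ofReal (one_div_nonneg.2 hp0.le)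
      (one_div_nonneg.2 hpp.symm.nonneg) (by simpa using hpp.inv_add_inv_eq_one)))
    rw [← lintegral_const_mul' _ _ ENNReal.ofReal_ne_top]
    refine lintegral_congr_ae ?_
    filter_upwards [hm'] with x hx
    rw [← ofReal_norm, norm_smul, Real.norm_eq_abs, (hFe _ hx).2,
      ENNReal.ofReal_rpow_of_nonneg (by positivity) (by positivity),
      ENNReal.ofReal_rpow_of_nonneg (by positivity) (one_div_nonneg.2 hpp.symm.nonneg),
      ← ENNReal.ofReal_mul (by positivity), ← ENNReal.ofReal_mul (by linarith)]
    congr 1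
    rw [abs_of_nonneg (by positivity), Real.mul_rpow (by positivity) (by positivity),
      ← Real.rpow_mul (norm_nonneg _), mul_one_div_cancel hp0.ne', Real.rpow_one,
      ← Real.rpow_mul (abs_nonneg _), ← Real.rpow_mul (abs_nonneg _)]
    have hsplit : |u x| ^ (β - 1) = |u x| ^ (s * (1 / p)) * |u x| ^ (Q * (1 / p')) := by
      have hp'0 := hpp.symm.pos
      rw [← Real.rpow_add_of_nonneg (abs_nonneg _) (by positivity)
        (mul_nonneg (by linarith) (one_div_nonneg.2 hp'0.le))]
      congr 1
      rw [hQ]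
      field_simp
      ring
    rw [hsplit]
    ring
  rw [e1] at hgns
  have h3 := hgns.trans (mul_le_mul' le_rfl e2)
  rw [← ENNReal.ofReal_coe_nnreal, ← ENNReal.ofReal_mul NNReal.zero_le_coe,
    ENNReal.ofReal_le_ofReal_iff (by positivity)] at h3
  refine h3.trans (le_of_eq ?_)
  ring

/-! ### Energy estimates for critical points -/

theorem IsCaratheodory.aemeasurable_comp {k : ℕ} {h : E N → ℝ → ℝ} (hh : IsCaratheodory k h)
    {u : E N → ℝ} (hu : AEMeasurable u volume) : AEMeasurable (fun x => h x (u x)) volume :=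
  aemeasurable_comp_of_caratheodory hh.1 (hh.2.mono fun _ hx => hx.continuous) hu

/-- Measurability of `A_t(·, t)` comes from difference quotients with step `1/(n+1)`. -/
theorem IsCaratheodory.partialT {A : E N → ℝ → ℝ} (hA : IsCaratheodory 1 A) :
    IsCaratheodory 0 (partialT A) := by
  refine ⟨fun t => ?_, ?_⟩
  · refine aemeasurable_of_tendsto_metrizable_ae atTop
      (f := fun (n : ℕ) x => ((1 : ℝ) / (n + 1))⁻¹ • (A x (t + 1 / (n + 1)) - A x t)) ?_ ?_
    · exact fun n => ((hA.1 (t + 1 / (n + 1))).sub (hA.1 t)).const_smul ((1 : ℝ) / (n + 1))⁻¹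
    · filter_upwards [hA.2] with x hx
      have hd : HasDerivAt (A x) (deriv (A x) t) t :=
        ((hx.differentiable (by simp)) t).hasDerivAt
      refine (hasDerivAt_iff_tendsto_slope_zero.1 hd).comp ?_
      refine tendsto_nhdsWithin_iff.2 ⟨tendsto_one_div_add_atTop_nhds_zero_nat,
        Eventually.of_forall fun n => ?_⟩
      have : (0 : ℝ) < 1 / ((n : ℝ) + 1) := by positivity
      exact this.ne'
  · filter_upwards [hA.2] with x hx
    have h1 : ContDiff ℝ 1 (A x) := by simpa using hx
    exact contDiff_zero.2 (h1.continuous_deriv le_rfl)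

/-- This replaces `|t|^s t` in the test function. The shift by `ε` removes the singularity at `0`,
and a bump equal to `1` near `[-m, m]` makes the derivative bounded. Smoothness, not just `C¹`, is
needed for `F ∘ φ_n` to be again smooth approximants in `W_0^{1,p}`. The derivative exceeds `(t² +
ε)^(s/2)` by `s t² (t² + ε)^(s/2-1) ≥ 0`. -/
theorem exists_smooth_power {ε s m : ℝ} (hε : 0 < ε) (hs : 0 ≤ s) (hm : 0 ≤ m) :
    ∃ F : ℝ → ℝ, ∃ B : ℝ, ContDiff ℝ ∞ F ∧ F 0 = 0 ∧ (∀ t, |deriv F t| ≤ B) ∧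
      ∀ t, |t| ≤ m → F t = (t ^ 2 + ε) ^ (s / 2) * t ∧ (t ^ 2 + ε) ^ (s / 2) ≤ deriv F t := by
  let η : ContDiffBump (0 : ℝ) := ⟨m + 1, m + 2, by linarith, by linarith⟩
  have hpos : ∀ t : ℝ, 0 < t ^ 2 + ε := fun t => by positivity
  set f : ℝ → ℝ := fun t => (t ^ 2 + ε) ^ (s / 2) * t with hf
  have hfs : ContDiff ℝ ∞ f :=
    (ContDiff.rpow_const_of_ne (by fun_prop) fun t => (hpos t).ne').mul contDiff_id
  have hη : ContDiff ℝ ∞ η := η.contDiff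
  have hFs : ContDiff ℝ ∞ fun t => f t * η t := hfs.mul hη
  have hFc : HasCompactSupport fun t => f t * η t := η.hasCompactSupport.mul_left
  obtain ⟨B, hB⟩ := (hFs.continuous_deriv (by simp)).bounded_above_of_compact_support hFc.deriv
  refine ⟨fun t => f t * η t, B, hFs, by simp [hf], hB, fun t ht => ?_⟩
  have hev : (fun t => f t * η t) =ᶠ[𝓝 t] f := by
    have : ∀ᶠ y in 𝓝 t, |y| < m + 1 := continuous_abs.continuousAt.eventually_lt
      continuousAt_const (by linarith)
    filter_upwards [this] with y hy
    rw [η.one_of_mem_closedBall (by simpa using hy.le), mul_one]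
  refine ⟨hev.self_of_nhds, ?_⟩
  rw [hev.deriv_eq]
  have h1 : HasDerivAt (fun t : ℝ => t ^ 2 + ε) (2 * t) t := by
    simpa using (hasDerivAt_pow 2 t).add_const ε
  have h2 := (h1.rpow_const (p := s / 2) (Or.inl (hpos t).ne')).mul (hasDerivAt_id t)
  have h3 : deriv f t = _ := h2.deriv
  rw [h3]
  have h4 : 0 ≤ (t ^ 2 + ε) ^ (s / 2 - 1) := Real.rpow_nonneg (hpos t).le _
  have h5 : 0 ≤ 2 * t * (s / 2) * (t ^ 2 + ε) ^ (s / 2 - 1) * t := by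
    have : 2 * t * (s / 2) * (t ^ 2 + ε) ^ (s / 2 - 1) * t
      = s * t ^ 2 * (t ^ 2 + ε) ^ (s / 2 - 1) := by ring
    rw [this]
    positivity
  simp only [id]
  linarith

/-- For `p ≤ 2` the value of `a^(p-2)` at `a = 0` is a convention; the factor `a * a` makes it
irrelevant. -/
theorem rpow_sub_two_mul_sq {p a : ℝ} (hp : 1 < p) (ha : 0 ≤ a) :
    a ^ (p - 2) * (a * a) = a ^ p := by
  rcases ha.eq_or_lt with rfl | ha
  · rw [mul_zero, mul_zero, Real.zero_rpow (by linarith)]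
  · rw [← pow_two, ← Real.rpow_natCast a 2, ← Real.rpow_add ha]
    norm_num

theorem exists_ae_abs_le {u : E N → ℝ} (hu : MemLp u ⊤ volume) :
    ∃ m, 0 < m ∧ ∀ᵐ x, |u x| ≤ m := by
  refine ⟨max (eLpNorm u ⊤ volume).toReal 1, by positivity, ?_⟩
  filter_upwards [ae_le_eLpNormEssSup (f := u) (μ := volume)] with x hx
  refine le_trans ?_ (le_max_left _ _)
  rw [eLpNorm_exponent_top, ← Real.norm_eq_abs, ← toReal_enorm]
  exact ENNReal.toReal_mono hu.2.ne hx

section critical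

variable {p q μ α₀ m : ℝ} {Ω : Set (E N)} {A : E N → ℝ → ℝ} {V : E N → ℝ} {g : E N → ℝ → ℝ}
  {u : E N → ℝ} {F : ℝ → ℝ} {B : ℝ}

theorem MemXZero.comp (hp : 1 ≤ p) (hV : AEMeasurable V volume) (hu : MemXZero V p Ω u)
    (hF : ContDiff ℝ ∞ F) (hF0 : F 0 = 0) (hB : ∀ t, |deriv F t| ≤ B) :
    MemXZero V p Ω fun x => F (u x) := by
  have hF1 : ContDiff ℝ 1 F := hF.of_le (by exact_mod_cast le_top)
  have hW := (hu.1.comp hp hF hF0 hB).1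
  have hB0 : 0 ≤ B := (abs_nonneg _).trans (hB 0)
  refine ⟨hW, ?_, memLp_comp hF1 hF0 hB hu.2.2⟩
  refine (hu.2.1.norm.const_mul (B ^ p)).mono'
    (hV.mul (hW.1.1.1.norm.aemeasurable.pow_const p)).aestronglyMeasurable
    (Eventually.of_forall fun x => ?_)
  have h1 : |F (u x)| ≤ B * |u x| := by
    simpa [hF0] using abs_sub_le_of_abs_deriv_le hF1 hB (u x) 0
  rw [norm_mul, norm_mul, Real.norm_of_nonneg (r := |F (u x)| ^ p) (by positivity),
    Real.norm_of_nonneg (r := |u x| ^ p) (by positivity), mul_left_comm,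
    ← Real.mul_rpow hB0 (abs_nonneg _)]
  gcongr

theorem integrable_coefficient_mul_gradient (hp : 1 < p) (hA0 : IsCaratheodory 1 A)
    (hA1 : HypH1 A) (hu : MemW p u) (hm : ∀ᵐ x, |u x| ≤ m) (hm0 : 0 < m) (hF : ContDiff ℝ 1 F)
    (hF0 : F 0 = 0) (hB : ∀ t, |deriv F t| ≤ B) :
    Integrable (fun x => A x (u x) * ‖weakGrad u x‖ ^ p) volume ∧
    Integrable (fun x => A x (u x) * deriv F (u x) * ‖weakGrad u x‖ ^ p) volume ∧
      Integrable (fun x => partialT A x (u x) * F (u x) * ‖weakGrad u x‖ ^ p) volume := by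
  obtain ⟨C, hC⟩ := hA1 m hm0
  have hB0 : 0 ≤ B := (abs_nonneg _).trans (hB 0)
  have hum := hu.1.1.aemeasurable
  have hw := integrable_norm_rpow_of_memLp (by linarith) hu.memLp_weakGrad
  refine ⟨?_, ?_, ?_⟩
  · refine integrable_bdd_mul (C := C) (hA0.aemeasurable_comp hum).aestronglyMeasurable ?_ hw
    filter_upwards [hC, hm] with x hx hmx
    exact (hx _ hmx).1
  · refine integrable_bdd_mul (C := C * B) ((hA0.aemeasurable_comp hum).aestronglyMeasurable.mul
      ((hF.continuous_deriv le_rfl).comp_aestronglyMeasurable hu.1.1)) ?_ hw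
    filter_upwards [hC, hm] with x hx hmx
    rw [abs_mul]
    exact mul_le_mul (hx _ hmx).1 (hB _) (abs_nonneg _) ((abs_nonneg _).trans (hx _ hmx).1)
  · refine integrable_bdd_mul (C := C * (B * m))
      ((hA0.partialT.aemeasurable_comp hum).aestronglyMeasurable.mul
      (hF.continuous.comp_aestronglyMeasurable hu.1.1)) ?_ hw
    filter_upwards [hC, hm] with x hx hmx
    have h1 : |F (u x)| ≤ B * |u x| := by
      simpa [hF0] using abs_sub_le_of_abs_deriv_le hF hB (u x) 0
    rw [abs_mul]
    exact mul_le_mul (hx _ hmx).2 (h1.trans (by gcongr)) (abs_nonneg _)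
      ((abs_nonneg _).trans (hx _ hmx).2)

theorem dJ_comp (hp : 1 < p) (hA0 : IsCaratheodory 1 A) (hA1 : HypH1 A) (hu : MemWZero p Ω u)
    (hm : ∀ᵐ x, |u x| ≤ m) (hm0 : 0 < m)
    (hF : ContDiff ℝ ∞ F) (hF0 : F 0 = 0) (hB : ∀ t, |deriv F t| ≤ B) :
    dJ p A V g u (fun x => F (u x)) =
      (∫ x, (A x (u x) * deriv F (u x) + 1 / p * (partialT A x (u x) * F (u x)))
        * ‖weakGrad u x‖ ^ p)
      + (∫ x, V x * |u x| ^ (p - 2) * u x * F (u x)) - ∫ x, g x (u x) * F (u x) := by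
  have hF1 : ContDiff ℝ 1 F := hF.of_le (by exact_mod_cast le_top)
  obtain ⟨-, i1, i2⟩ := integrable_coefficient_mul_gradient hp hA0 hA1 hu.1 hm hm0 hF1 hF0 hB
  have hae := (hu.comp hp.le hF hF0 hB).2
  have e1 : ∫ x, A x (u x) * ‖weakGrad u x‖ ^ (p - 2)
      * inner ℝ (weakGrad u x) (weakGrad (fun x => F (u x)) x)
      = ∫ x, A x (u x) * deriv F (u x) * ‖weakGrad u x‖ ^ p := by
    refine integral_congr_ae ?_
    filter_upwards [hae] with x hx
    rw [hx, real_inner_smul_right, real_inner_self_eq_norm_mul_norm,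
      ← rpow_sub_two_mul_sq hp (norm_nonneg _)]
    ring
  rw [dJ, e1, ← integral_const_mul, ← integral_add i1 (i2.const_mul _)]
  congr 3
  ext x
  ring

/-- Testing with `F(u)`, where `F(t) = θ(t) t` and `F' ≥ θ ≥ 0`. -/
theorem weighted_gradient_le (hp : 1 < p) {α₂ : ℝ} (hα₂ : 0 < α₂) (hA0 : IsCaratheodory 1 A)
    (hA1 : HypH1 A) (hA2 : HypH2 α₀ A)
    (hA4 : ∀ᵐ x : E N, ∀ t : ℝ, α₂ * A x t ≤ p * A x t + partialT A x t * t)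
    (hV1 : HypV1 V) (hu : MemWZero p Ω u)
    (hm : ∀ᵐ x, |u x| ≤ m) (hm0 : 0 < m)
    (hF : ContDiff ℝ ∞ F) (hF0 : F 0 = 0) (hB : ∀ t, |deriv F t| ≤ B)
    {θ : ℝ → ℝ} (hθ0 : ∀ t, 0 ≤ θ t) (hθc : Continuous θ)
    (hθ : ∀ t, |t| ≤ m → F t = θ t * t ∧ θ t ≤ deriv F t)
    (hcrit : dJ p A V g u (fun x => F (u x)) = 0) :
    α₂ * α₀ / p * ∫ x, θ (u x) * ‖weakGrad u x‖ ^ p ≤ ∫ x, g x (u x) * F (u x) := by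
  have hF1 : ContDiff ℝ 1 F := hF.of_le (by exact_mod_cast le_top)
  have hp0 : 0 < p := by linarith
  obtain ⟨-, i1, i2⟩ := integrable_coefficient_mul_gradient hp hA0 hA1 hu.1 hm hm0 hF1 hF0 hB
  rw [dJ_comp hp hA0 hA1 hu hm hm0 hF hF0 hB] at hcrit
  have hVn : 0 ≤ ∫ x, V x * |u x| ^ (p - 2) * u x * F (u x) := by
    obtain ⟨c, hc, hV⟩ := hV1
    refine integral_nonneg_of_ae ?_
    filter_upwards [hV, hm] with x hx hmx
    have : V x * |u x| ^ (p - 2) * u x * F (u x)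
        = V x * |u x| ^ (p - 2) * θ (u x) * (u x * u x) := by
      rw [(hθ _ hmx).1]
      ring
    rw [Pi.zero_apply, this]
    have := hθ0 (u x)
    have : 0 ≤ V x := by linarith
    have := mul_self_nonneg (u x)
    positivity
  have hw := integrable_norm_rpow_of_memLp hp0 hu.1.memLp_weakGrad
  obtain ⟨T, hT⟩ := (isCompact_Icc (a := -m) (b := m)).exists_bound_of_continuousOn
    hθc.continuousOn
  have i3 : Integrable (fun x => θ (u x) * ‖weakGrad u x‖ ^ p) volume := by
    refine integrable_bdd_mul (C := T) (hθc.comp_aestronglyMeasurable hu.1.1.1) ?_ hw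
    filter_upwards [hm] with x hx
    exact hT _ (abs_le.1 hx)
  have hmain : α₂ * α₀ / p * ∫ x, θ (u x) * ‖weakGrad u x‖ ^ p ≤
      ∫ x, (A x (u x) * deriv F (u x) + 1 / p * (partialT A x (u x) * F (u x)))
        * ‖weakGrad u x‖ ^ p := by
    rw [← integral_const_mul]
    refine integral_mono_ae (i3.const_mul _) ((i1.add (i2.const_mul (1 / p))).congr
      (Eventually.of_forall fun x => ?_)) ?_
    · simp only [Pi.add_apply]
      ring
    · filter_upwards [hA2.2, hA4, hm] with x h2 h4 hmx
      have h2 := h2 (u x)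
      have h4 := h4 (u x)
      obtain ⟨hf, hd⟩ := hθ _ hmx
      rw [← mul_assoc]
      refine mul_le_mul_of_nonneg_right ?_ (by positivity)
      have hA : 0 ≤ A x (u x) := hA2.1.le.trans h2
      have hθn := hθ0 (u x)
      -- Replacing `F'` by the smaller `θ` brings out the common factor `θ/p` of `p A + A_t u`, to
      -- which the lower bound `α₂ A ≥ α₂ α₀` applies.
      have s1 : A x (u x) * θ (u x) ≤ A x (u x) * deriv F (u x) :=
        mul_le_mul_of_nonneg_left hd hA
      have s2 : α₂ * α₀ ≤ p * A x (u x) + partialT A x (u x) * u x :=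
        (mul_le_mul_of_nonneg_left h2 hα₂.le).trans h4
      have s3 := mul_le_mul_of_nonneg_right s2 (div_nonneg hθn hp0.le)
      rw [hf]
      calc α₂ * α₀ / p * θ (u x) = α₂ * α₀ * (θ (u x) / p) := by ring
        _ ≤ _ := s3
        _ = A x (u x) * θ (u x) + 1 / p * (partialT A x (u x) * (θ (u x) * u x)) := by
          field_simp
        _ ≤ _ := by linarith
  linarith

/-- The energy estimate behind Moser's iteration. -/
theorem power_energy_le (hp : 1 < p) (hpq : p ≤ q) {α₂ a₁ a₂ : ℝ} (hα₂ : 0 < α₂)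
    (ha₁ : 0 < a₁) (ha₂ : 0 < a₂) (hA0 : IsCaratheodory 1 A)
    (hA1 : HypH1 A) (hA2 : HypH2 α₀ A)
    (hA4 : ∀ᵐ x : E N, ∀ t : ℝ, α₂ * A x t ≤ p * A x t + partialT A x t * t)
    (hV : AEMeasurable V volume) (hV1 : HypV1 V) (hg0 : IsCaratheodory 0 g)
    (hg1 : ∀ᵐ x : E N, ∀ t : ℝ, |g x t| ≤ a₁ * |t| ^ (p - 1) + a₂ * |t| ^ (q - 1))
    (hu : MemXZero V p Ω u) (hm : ∀ᵐ x, |u x| ≤ m) (hm0 : 0 < m)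
    (hcrit : ∀ v, MemXZero V p Ω v → dJ p A V g u v = 0) {s : ℝ} (hs : 0 ≤ s) :
    α₂ * α₀ / p * ∫ x, |u x| ^ s * ‖weakGrad u x‖ ^ p ≤
      a₁ * (∫ x, |u x| ^ (p + s)) + a₂ * ∫ x, |u x| ^ (q + s) := by
  have hp0 : 0 < p := by linarith
  have hW := hu.1.1
  have hum := hW.1.1
  set Φ : E N → ℝ := fun x => a₁ * |u x| ^ p + a₂ * |u x| ^ q with hΦ
  have iΦ : Integrable Φ volume :=
    ((integrable_abs_rpow hp0 le_rfl hW.1 hm).const_mul _).add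
      ((integrable_abs_rpow hp0 hpq hW.1 hm).const_mul _)
  -- These weights decrease to `|t|^s` and are bounded uniformly in `n` for `|t| ≤ m`. On the left
  -- they are simply bounded below by `|t|^s`; only the right-hand side needs a limit.
  set θ : ℕ → ℝ → ℝ := fun n t => (t ^ 2 + 1 / ((n : ℝ) + 1)) ^ (s / 2) with hθ
  have hε : ∀ n : ℕ, (0 : ℝ) < 1 / ((n : ℝ) + 1) := fun n => by positivity
  have hθ0 : ∀ n t, 0 ≤ θ n t := fun n t => by positivity
  have hθc : ∀ n, Continuous (θ n) := fun n =>
    (by fun_prop : Continuous fun t : ℝ => t ^ 2 + 1 / ((n : ℝ) + 1)).rpow_const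
      fun _ => Or.inr (by linarith)
  have hθb : ∀ n t, |t| ≤ m → θ n t ≤ (m ^ 2 + 1) ^ (s / 2) := by
    intro n t ht
    have h1 : t ^ 2 ≤ m ^ 2 := sq_le_sq' (abs_le.1 ht).1 (abs_le.1 ht).2
    have h2 : 1 / ((n : ℝ) + 1) ≤ 1 := by
      rw [div_le_one (by positivity)]
      linarith [(Nat.cast_nonneg n : (0 : ℝ) ≤ n)]
    exact Real.rpow_le_rpow (by positivity) (by linarith) (by linarith)
  have hθi : ∀ n, Integrable (fun x => θ n (u x) * Φ x) volume := fun n =>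
    integrable_bdd_mul (C := (m ^ 2 + 1) ^ (s / 2)) ((hθc n).comp_aestronglyMeasurable hum)
      (by filter_upwards [hm] with x hx
          rw [abs_of_nonneg (hθ0 _ _)]
          exact hθb n _ hx) iΦ
  have hθs : ∀ n t, |t| ^ s ≤ θ n t := by
    intro n t
    have h1 : |t| ^ s = (t ^ 2) ^ (s / 2) := by
      rw [← sq_abs, ← Real.rpow_natCast, ← Real.rpow_mul (abs_nonneg _)]
      congr 1
      push_cast
      ring
    rw [h1]
    exact Real.rpow_le_rpow (by positivity) (by linarith [hε n]) (by linarith)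
  have iw := integrable_norm_rpow_of_memLp hp0 hW.memLp_weakGrad
  have hc0 : 0 ≤ α₂ * α₀ / p := by
    have := hA2.1
    positivity
  have hn : ∀ n, α₂ * α₀ / p * ∫ x, |u x| ^ s * ‖weakGrad u x‖ ^ p ≤ ∫ x, θ n (u x) * Φ x := by
    intro n
    obtain ⟨F, B, hF, hF0, hB, hFe⟩ := exists_smooth_power (hε n) hs hm0.le
    have h1 := weighted_gradient_le hp hα₂ hA0 hA1 hA2 hA4 hV1 hu.1 hm hm0 hF hF0 hB
      (hθ0 n) (hθc n) hFe (hcrit _ (hu.comp hp.le hV hF hF0 hB))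
    have h2 : ∫ x, |u x| ^ s * ‖weakGrad u x‖ ^ p ≤ ∫ x, θ n (u x) * ‖weakGrad u x‖ ^ p := by
      refine integral_mono_of_nonneg (Eventually.of_forall fun x => by positivity) ?_
        (Eventually.of_forall fun x =>
          mul_le_mul_of_nonneg_right (hθs n (u x)) (by positivity))
      refine integrable_bdd_mul (C := (m ^ 2 + 1) ^ (s / 2))
        ((hθc n).comp_aestronglyMeasurable hum) ?_ iw
      filter_upwards [hm] with x hx
      rw [abs_of_nonneg (hθ0 _ _)]
      exact hθb n _ hx
    refine (mul_le_mul_of_nonneg_left h2 hc0).trans (h1.trans ?_)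
    have hb : ∀ᵐ x, |g x (u x) * F (u x)| ≤ θ n (u x) * Φ x := by
      filter_upwards [hg1, hm] with x hx hmx
      rw [(hFe _ hmx).1, abs_mul, abs_mul, abs_of_nonneg (hθ0 n (u x))]
      have h3 : |g x (u x)| * |u x| ≤ Φ x := by
        refine (mul_le_mul_of_nonneg_right (hx (u x)) (abs_nonneg _)).trans (le_of_eq ?_)
        have e : ∀ r : ℝ, 1 < r → |u x| ^ (r - 1) * |u x| = |u x| ^ r := by
          intro r hr
          nth_rewrite 2 [← Real.rpow_one |u x|]
          rw [← Real.rpow_add_of_nonneg (abs_nonneg _) (by linarith) zero_le_one]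
          congr 1
          ring
        simp only [hΦ]
        rw [add_mul, mul_assoc, mul_assoc, e p hp, e q (by linarith)]
      calc |g x (u x)| * (θ n (u x) * |u x|) = θ n (u x) * (|g x (u x)| * |u x|) := by ring
        _ ≤ _ := mul_le_mul_of_nonneg_left h3 (hθ0 _ _)
    refine integral_mono_ae ((hθi n).mono' ?_ hb) (hθi n)
      (hb.mono fun x hx => (le_abs_self _).trans hx)
    exact ((hg0.aemeasurable_comp hum.aemeasurable).mul
      (hF.continuous.comp_aestronglyMeasurable hum).aemeasurable).aestronglyMeasurable
  have hlim : Tendsto (fun n => ∫ x, θ n (u x) * Φ x) atTop (𝓝 (∫ x, |u x| ^ s * Φ x)) := by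
    refine tendsto_integral_of_dominated_convergence
      (fun x => (m ^ 2 + 1) ^ (s / 2) * Φ x) (fun n => (hθi n).1) (iΦ.const_mul _) ?_ ?_
    · intro n
      filter_upwards [hm] with x hx
      have hΦ0 : 0 ≤ Φ x := by positivity
      rw [Real.norm_of_nonneg (mul_nonneg (hθ0 _ _) hΦ0)]
      exact mul_le_mul_of_nonneg_right (hθb n _ hx) hΦ0
    · refine Eventually.of_forall fun x => Tendsto.mul_const _ ?_
      have h1 : |u x| ^ s = (u x ^ 2 + 0) ^ (s / 2) := by
        rw [add_zero, ← sq_abs, ← Real.rpow_natCast, ← Real.rpow_mul (abs_nonneg _)]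
        congr 1
        push_cast
        ring
      rw [h1]
      exact (tendsto_const_nhds.add tendsto_one_div_add_atTop_nhds_zero_nat).rpow_const
        (Or.inr (by linarith))
  refine (ge_of_tendsto' hlim hn).trans (le_of_eq ?_)
  rw [← integral_const_mul, ← integral_const_mul, ← integral_add
    ((integrable_abs_rpow hp0 (by linarith) hW.1 hm).const_mul _)
    ((integrable_abs_rpow hp0 (by linarith) hW.1 hm).const_mul _)]
  refine integral_congr_ae (Eventually.of_forall fun x => ?_)
  simp only [hΦ]
  rw [Real.rpow_add_of_nonneg (abs_nonneg _) hp0.le hs,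
    Real.rpow_add_of_nonneg (abs_nonneg _) (by linarith) hs]
  ring

/-- A critical point is bounded in `W_V^{1,p}` in terms of its energy. -/
theorem energy_le_of_critical (hp : 1 < p) (hpq : p ≤ q) {α₁ a₁ a₂ : ℝ} (hα₁ : 0 < α₁)
    (hA0 : IsCaratheodory 1 A)
    (hA1 : HypH1 A) (hA2 : HypH2 α₀ A) (hμ : p < μ)
    (hA3 : ∀ᵐ x : E N, ∀ t : ℝ, α₁ * A x t ≤ (μ - p) * A x t - partialT A x t * t)
    (hg0 : IsCaratheodory 0 g)
    (hg1 : ∀ᵐ x : E N, ∀ t : ℝ, |g x t| ≤ a₁ * |t| ^ (p - 1) + a₂ * |t| ^ (q - 1))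
    (hg3 : HypG3 μ g)
    (hu : MemXZero V p Ω u) (hm : ∀ᵐ x, |u x| ≤ m) (hm0 : 0 < m)
    (hcrit : dJ p A V g u u = 0) :
    α₁ * α₀ / p * (∫ x, ‖weakGrad u x‖ ^ p) + (μ - p) / p * (∫ x, V x * |u x| ^ p) ≤
      μ * J p A V g u := by
  have hp0 : 0 < p := by linarith
  have hW := hu.1.1
  have hum := hW.1.1
  have hid : ∀ t : ℝ, |deriv (fun t : ℝ => t) t| ≤ 1 := fun t => by simp
  obtain ⟨i0, -, i2⟩ := integrable_coefficient_mul_gradient (F := fun t => t) hp hA0 hA1 hW hm hm0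
    contDiff_id rfl hid
  have hd := dJ_comp (V := V) (g := g) (F := fun t => t) hp hA0 hA1 hu.1 hm hm0 contDiff_id rfl hid
  simp only [deriv_id'', mul_one] at hd
  have hVe : ∫ x, V x * |u x| ^ (p - 2) * u x * u x = ∫ x, V x * |u x| ^ p := by
    refine integral_congr_ae (Eventually.of_forall fun x => ?_)
    simp only
    rw [← rpow_sub_two_mul_sq hp (abs_nonneg (u x)), abs_mul_abs_self]
    ring
  have hsplit : ∫ x, (A x (u x) + 1 / p * (partialT A x (u x) * u x)) * ‖weakGrad u x‖ ^ p
      = (∫ x, A x (u x) * ‖weakGrad u x‖ ^ p)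
        + 1 / p * ∫ x, partialT A x (u x) * u x * ‖weakGrad u x‖ ^ p := by
    rw [← integral_const_mul, ← integral_add i0 (i2.const_mul _)]
    refine integral_congr_ae (Eventually.of_forall fun x => ?_)
    simp only
    ring
  have iw := integrable_norm_rpow_of_memLp hp0 hW.memLp_weakGrad
  have hgrad : α₁ * α₀ * (∫ x, ‖weakGrad u x‖ ^ p) ≤
      (μ - p) * (∫ x, A x (u x) * ‖weakGrad u x‖ ^ p)
        - ∫ x, partialT A x (u x) * u x * ‖weakGrad u x‖ ^ p := by
    rw [← integral_const_mul, ← integral_const_mul, ← integral_sub (i0.const_mul _) i2]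
    refine integral_mono_ae (iw.const_mul _) ((i0.const_mul _).sub i2) ?_
    filter_upwards [hA2.2, hA3] with x h2 h3
    have h := (mul_le_mul_of_nonneg_left (h2 (u x)) hα₁.le).trans (h3 (u x))
    refine (mul_le_mul_of_nonneg_right h (by positivity)).trans (le_of_eq ?_)
    ring
  have ig : Integrable (fun x => g x (u x) * u x) volume := by
    refine (((integrable_abs_rpow hp0 le_rfl hW.1 hm).const_mul a₁).add
      ((integrable_abs_rpow hp0 hpq hW.1 hm).const_mul a₂)).mono'
      ((hg0.aemeasurable_comp hum.aemeasurable).mul hum.aemeasurable).aestronglyMeasurable ?_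
    filter_upwards [hg1] with x hx
    rw [norm_mul, Real.norm_eq_abs, Real.norm_eq_abs]
    refine (mul_le_mul_of_nonneg_right (hx (u x)) (abs_nonneg _)).trans (le_of_eq ?_)
    have e : ∀ r : ℝ, 1 < r → |u x| ^ (r - 1) * |u x| = |u x| ^ r := by
      intro r hr
      nth_rewrite 2 [← Real.rpow_one |u x|]
      rw [← Real.rpow_add_of_nonneg (abs_nonneg _) (by linarith) zero_le_one]
      congr 1
      ring
    simp only [Pi.add_apply]
    rw [add_mul, mul_assoc, mul_assoc, e p hp, e q (by linarith)]
  have hμ0 : 0 < μ := by linarith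
  have hG : μ * ∫ x, primitive g x (u x) ≤ ∫ x, g x (u x) * u x := by
    rw [← integral_const_mul]
    -- Positivity of `G` allows a comparison of integrals that needs only `g(x,u) u` to be
    -- integrable. The case `u x = 0` is separate, as the hypothesis excludes `t = 0`.
    have hb : ∀ᵐ x, 0 ≤ μ * primitive g x (u x) ∧ μ * primitive g x (u x) ≤ g x (u x) * u x := by
      filter_upwards [hg3] with x hx
      by_cases h0 : u x = 0
      · simp [h0, primitive]
      · exact ⟨(hx _ h0).1.le, (hx _ h0).2⟩
    exact integral_mono_of_nonneg (hb.mono fun x hx => hx.1) ig (hb.mono fun x hx => hx.2)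
  rw [hd, hVe, hsplit] at hcrit
  rw [J]
  have hgrad' := mul_le_mul_of_nonneg_left hgrad (one_div_nonneg.2 hp0.le)
  have e1 : α₁ * α₀ / p = 1 / p * (α₁ * α₀) := by ring
  have e2 : (μ - p) / p = 1 / p * μ - 1 := by field_simp
  have e3 : 1 / p * p = 1 := by field_simp
  rw [e1, e2]
  set X := ∫ x, A x (u x) * ‖weakGrad u x‖ ^ p
  set Y := ∫ x, partialT A x (u x) * u x * ‖weakGrad u x‖ ^ p
  set Z := ∫ x, V x * |u x| ^ p
  have e4 : 1 / p * ((μ - p) * X - Y) = 1 / p * μ * X - (1 / p * p) * X - 1 / p * Y := by ring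
  rw [e4, e3] at hgrad'
  linear_combination hgrad' + hG - hcrit

end critical

/-! ### Moser's iteration for a family of moments -/

/-- Inequalities satisfied by the moments `M r = ∫ |u|^r` of a critical point. -/
structure MomentInequalities (p p' q χ C K L : ℝ) (M : ℝ → ℝ) : Prop where
  nonneg : ∀ r, 0 ≤ M r
  base : M p ≤ L
  interp : ∀ a t b, p ≤ a → a < b → a ≤ t → t ≤ b →
    M t ≤ M a ^ ((b - t) / (b - a)) * M b ^ ((t - a) / (b - a))
  sobolev : ∀ β, 1 < β → p ≤ (β - 1) * p' → p ≤ β * χ →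
    M (β * χ) ≤ (C * β * L ^ (1 / p) * M ((β - 1) * p') ^ (1 / p')) ^ χ
  energy : ∀ s, 0 ≤ s → M ((p + s) * χ) ≤
    (C * (p + s) * (K * (M (p + s) + M (q + s))) ^ (1 / p) * M (p + s) ^ (1 / p')) ^ χ

/-- Absorption: a number controlled by a power of itself below one is bounded. It turns the mere
finiteness of the moments of `u_k` into bounds independent of `k`. -/
theorem le_rpow_of_le_mul_rpow {z K θ : ℝ} (hz : 1 ≤ z) (hθ : θ < 1)
    (h : z ≤ K * z ^ θ) : z ≤ K ^ (1 / (1 - θ)) := by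
  have hz0 : 0 < z := by linarith
  have h1 : z ^ (1 - θ) ≤ K := by
    rw [Real.rpow_sub hz0, Real.rpow_one, div_le_iff₀ (by positivity)]
    exact h
  have h2 := Real.rpow_le_rpow (by positivity) h1 (z := 1 / (1 - θ))
    (one_div_nonneg.2 (by linarith))
  rwa [← Real.rpow_mul hz0.le, mul_one_div_cancel (by linarith), Real.rpow_one] at h2

namespace MomentInequalities

variable {p p' q χ C K L : ℝ} {M : ℝ → ℝ}

/-- Interpolation with the lower moment already bounded. Since `L₀ ≥ 1`, its exponent may be raised
to `1`; the maximum with `1` prepares the absorption. -/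
theorem le_mul_rpow (h : MomentInequalities p p' q χ C K L M) {a b t L₀ : ℝ} (hL : 1 ≤ L₀)
    (ha : p ≤ a) (hab : a < b) (hat : a ≤ t) (htb : t ≤ b) (hM : M a ≤ L₀) :
    M t ≤ L₀ * (max 1 (M b)) ^ ((t - a) / (b - a)) := by
  have hd : 0 < b - a := by linarith
  refine (h.interp a t b ha hab hat htb).trans ?_
  refine mul_le_mul ?_ ?_ (Real.rpow_nonneg (h.nonneg _) _) (by linarith)
  · refine (Real.rpow_le_rpow (h.nonneg _) hM (div_nonneg (by linarith) hd.le)).trans ?_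
    conv_rhs => rw [← Real.rpow_one L₀]
    refine Real.rpow_le_rpow_of_exponent_le hL ?_
    rw [div_le_one hd]
    linarith
  · exact Real.rpow_le_rpow (h.nonneg _) (le_max_right _ _) (div_nonneg (by linarith) hd.le)

theorem le_add (h : MomentInequalities p p' q χ C K L M) {a b t : ℝ}
    (ha : p ≤ a) (hab : a < b) (hat : a ≤ t) (htb : t ≤ b) : M t ≤ M a + M b := by
  have hd : 0 < b - a := by linarith
  have h1 : (b - t) / (b - a) ≤ 1 := by rw [div_le_one hd]; linarith
  have h2 : (t - a) / (b - a) ≤ 1 := by rw [div_le_one hd]; linarith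
  have := Real.geom_mean_le_arith_mean2_weighted (w₁ := (b - t) / (b - a))
    (w₂ := (t - a) / (b - a)) (div_nonneg (by linarith) hd.le) (div_nonneg (by linarith) hd.le)
    (h.nonneg a) (h.nonneg b) (by field_simp; ring)
  refine (h.interp a t b ha hab hat htb).trans (this.trans ?_)
  exact add_le_add (mul_le_of_le_one_left (h.nonneg _) h1) (mul_le_of_le_one_left (h.nonneg _) h2)

/-- The bound of a moment of order up to the critical exponent. -/
theorem exists_bound_of_sobolev (hpp : p.HolderConjugate p') (hχ : 1 < χ) (hC : 1 ≤ C) (hL : 1 ≤ L)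
    {r : ℝ} (hr : χ * p ≤ r) (hQ : (r / χ - 1) * p' ≤ r) :
    ∃ B, 1 ≤ B ∧ ∀ M, MomentInequalities p p' q χ C K L M → M r ≤ B := by
  have hp := hpp.lt
  have hp0 := hpp.pos
  have hp'0 := hpp.symm.pos
  have hχ0 : 0 < χ := by linarith
  have hpr : p < r := by nlinarith
  have hβ : p ≤ r / χ := by rw [le_div_iff₀ hχ0]; linarith
  have hrχ : r / χ * χ = r := div_mul_cancel₀ _ hχ0.ne'
  have hpQ : p ≤ (r / χ - 1) * p' := by
    have : p = (p - 1) * p' := by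
      have := hpp.sub_one_mul_conj
      linarith
    nlinarith
  set β := r / χ with hβd
  set θ := ((β - 1) * p' - p) / (r - p) with hθ
  set D := C * β * L ^ (1 / p) * L ^ (1 / p') with hD
  have hD1 : 1 ≤ D := by
    have h1 : 1 ≤ L ^ (1 / p) := Real.one_le_rpow hL (by positivity)
    have h2 : 1 ≤ L ^ (1 / p') := Real.one_le_rpow hL (by positivity)
    have h3 : 1 ≤ C * β := one_le_mul_of_one_le_of_one_le hC (by linarith)
    exact one_le_mul_of_one_le_of_one_le (one_le_mul_of_one_le_of_one_le h3 h1) h2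
  have hDχ : 1 ≤ D ^ χ := Real.one_le_rpow hD1 hχ0.le
  have hθ1 : θ * (1 / p') * χ < 1 := by
    -- The power of `M r` produced by interpolating between `M p` and `M r` is below one because `χ
    -- > 1`, so it can be absorbed.
    have e : θ * (1 / p') * χ = (r - χ * p) / (r - p) := by
      have e1 : p / p' = p - 1 := hpp.div_conj_eq_sub_one
      have e2 : θ * (1 / p') * χ = ((β - 1) * (p' / p') - p / p') * χ / (r - p) := by
        rw [hθ]; ring
      rw [e2, e1, div_self hp'0.ne']
      congr 1
      linear_combination hrχ
    rw [e, div_lt_one (by linarith)]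
    nlinarith
  refine ⟨(D ^ χ) ^ (1 / (1 - θ * (1 / p') * χ)),
    Real.one_le_rpow hDχ (one_div_nonneg.2 (by linarith)), fun M h => ?_⟩
  have hz : 1 ≤ max 1 (M r) := le_max_left _ _
  refine (le_max_right 1 (M r)).trans (le_rpow_of_le_mul_rpow hz hθ1 ?_)
  set z := max 1 (M r) with hzd
  have hz0 : 0 ≤ z := by linarith
  have hθ0 : 0 ≤ θ := div_nonneg (by linarith) (by linarith)
  have h1 := h.sobolev β (by linarith) hpQ (by linarith)
  rw [hrχ] at h1
  have h2 : M ((β - 1) * p') ≤ L * z ^ θ := h.le_mul_rpow hL le_rfl hpr hpQ hQ h.base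
  have hL0 : 0 ≤ L := by linarith
  have h3 : M ((β - 1) * p') ^ (1 / p') ≤ L ^ (1 / p') * z ^ (θ * (1 / p')) := by
    refine (Real.rpow_le_rpow (h.nonneg _) h2 (by positivity)).trans (le_of_eq ?_)
    rw [Real.mul_rpow hL0 (by positivity), ← Real.rpow_mul hz0]
  have hCβ : 0 ≤ C * β * L ^ (1 / p) := by
    have : 0 ≤ β := by linarith
    positivity
  have h4 : M r ≤ D ^ χ * z ^ (θ * (1 / p') * χ) := by
    refine h1.trans ?_
    rw [Real.rpow_mul hz0, ← Real.mul_rpow (by linarith) (by positivity)]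
    refine Real.rpow_le_rpow (mul_nonneg hCβ (Real.rpow_nonneg (h.nonneg _) _)) ?_ hχ0.le
    rw [hD, mul_assoc (C * β * L ^ (1 / p))]
    exact mul_le_mul_of_nonneg_left h3 hCβ
  refine max_le ?_ h4
  exact one_le_mul_of_one_le_of_one_le hDχ
    (Real.one_le_rpow hz (by positivity))

/-- The bound of a moment of arbitrarily high order. -/
theorem exists_bound_of_energy (hpp : p.HolderConjugate p') (hpq : p ≤ q) (hχ : 1 < χ) (hC : 1 ≤ C)
    (hK : 1 ≤ K) {L₀ : ℝ} (hL₀ : 1 ≤ L₀) {r s : ℝ} (hpr : p ≤ r) (hs : 0 ≤ s)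
    (hr : χ * (q - p) / p < (χ - 1) * r) (hrs : r ≤ p + s) (hqs : q + s ≤ (p + s) * χ) :
    ∃ B, ∀ M, MomentInequalities p p' q χ C K L M → M r ≤ L₀ → M ((p + s) * χ) ≤ B := by
  have hp := hpp.lt
  have hp0 := hpp.pos
  have hp'0 := hpp.symm.pos
  have hχ0 : 0 < χ := by linarith
  set R := (p + s) * χ with hR
  have hrR : r < R := by nlinarith
  set θ₁ := (p + s - r) / (R - r) with hθ₁
  set θ₂ := (q + s - r) / (R - r) with hθ₂
  have hd : 0 < R - r := by linarith
  have hθ₁0 : 0 ≤ θ₁ := div_nonneg (by linarith) hd.le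
  have hθ₁₂ : θ₁ ≤ θ₂ := div_le_div_of_nonneg_right (by linarith) hd.le
  set D := C * (p + s) * (K * (2 * L₀)) ^ (1 / p) * L₀ ^ (1 / p') with hD
  have hD1 : 1 ≤ D := by
    have h1 : 1 ≤ (K * (2 * L₀)) ^ (1 / p) :=
      Real.one_le_rpow (one_le_mul_of_one_le_of_one_le hK (by linarith)) (by positivity)
    have h2 : 1 ≤ L₀ ^ (1 / p') := Real.one_le_rpow hL₀ (by positivity)
    have h3 : 1 ≤ C * (p + s) := one_le_mul_of_one_le_of_one_le hC (by linarith)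
    exact one_le_mul_of_one_le_of_one_le (one_le_mul_of_one_le_of_one_le h3 h1) h2
  have hDχ : 1 ≤ D ^ χ := Real.one_le_rpow hD1 hχ0.le
  set θ := (θ₂ * (1 / p) + θ₁ * (1 / p')) * χ with hθ
  have hθ0 : 0 ≤ θ := by
    have : 0 ≤ θ₂ := hθ₁0.trans hθ₁₂
    positivity
  have hθ1 : θ < 1 := by
    have e : θ = (χ * (q - p) / p + χ * (p + s - r)) / (R - r) := by
      have e1 : 1 / p' = 1 - 1 / p := by
        have := hpp.inv_add_inv_eq_one
        rw [one_div, one_div]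
        linarith
      rw [hθ, hθ₁, hθ₂, e1]
      field_simp
      ring
    -- As `χ (p + s - r) = R - χ r`, the condition `θ < 1` is exactly `χ (q - p) / p < (χ - 1) r`,
    -- whatever `s` is.
    rw [e, div_lt_one hd]
    have : χ * (p + s - r) = R - χ * r := by rw [hR]; ring
    linarith
  refine ⟨(D ^ χ) ^ (1 / (1 - θ)), fun M h hMr => ?_⟩
  have hz : 1 ≤ max 1 (M R) := le_max_left _ _
  refine (le_max_right 1 (M R)).trans (le_rpow_of_le_mul_rpow hz hθ1 ?_)
  have h1 := h.energy s hs
  have m1 : M (p + s) ≤ L₀ * (max 1 (M R)) ^ θ₁ :=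
    h.le_mul_rpow hL₀ hpr hrR hrs (by linarith) hMr
  have m2 : M (q + s) ≤ L₀ * (max 1 (M R)) ^ θ₂ :=
    h.le_mul_rpow hL₀ hpr hrR (by linarith) hqs hMr
  set z := max 1 (M R) with hzd
  have hz0 : 0 < z := by linarith
  have hL0 : 0 ≤ L₀ := by linarith
  have hK0 : 0 ≤ K := by linarith
  have m3 : K * (M (p + s) + M (q + s)) ≤ K * (2 * L₀) * z ^ θ₂ := by
    have : z ^ θ₁ ≤ z ^ θ₂ := Real.rpow_le_rpow_of_exponent_le hz hθ₁₂
    have := mul_le_mul_of_nonneg_left this hL0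
    rw [mul_assoc]
    refine mul_le_mul_of_nonneg_left ?_ hK0
    linarith
  have s0 : 0 ≤ K * (M (p + s) + M (q + s)) :=
    mul_nonneg hK0 (add_nonneg (h.nonneg _) (h.nonneg _))
  have m4 : (K * (M (p + s) + M (q + s))) ^ (1 / p)
      ≤ (K * (2 * L₀)) ^ (1 / p) * z ^ (θ₂ * (1 / p)) := by
    refine (Real.rpow_le_rpow s0 m3 (by positivity)).trans (le_of_eq ?_)
    rw [Real.mul_rpow (by positivity) (by positivity), ← Real.rpow_mul hz0.le]
  have m5 : M (p + s) ^ (1 / p') ≤ L₀ ^ (1 / p') * z ^ (θ₁ * (1 / p')) := by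
    refine (Real.rpow_le_rpow (h.nonneg _) m1 (by positivity)).trans (le_of_eq ?_)
    rw [Real.mul_rpow hL0 (by positivity), ← Real.rpow_mul hz0.le]
  have hCs : 0 ≤ C * (p + s) := by
    have : 0 ≤ C := by linarith
    positivity
  have h4 : M R ≤ D ^ χ * z ^ θ := by
    refine h1.trans ?_
    rw [hθ, Real.rpow_mul hz0.le, ← Real.mul_rpow (by linarith) (by positivity),
      Real.rpow_add hz0]
    refine Real.rpow_le_rpow (mul_nonneg (mul_nonneg hCs (Real.rpow_nonneg s0 _))
      (Real.rpow_nonneg (h.nonneg _) _)) ?_ hχ0.le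
    calc C * (p + s) * (K * (M (p + s) + M (q + s))) ^ (1 / p) * M (p + s) ^ (1 / p')
        ≤ C * (p + s) * ((K * (2 * L₀)) ^ (1 / p) * z ^ (θ₂ * (1 / p)))
          * (L₀ ^ (1 / p') * z ^ (θ₁ * (1 / p'))) := by
          refine mul_le_mul (mul_le_mul_of_nonneg_left m4 hCs) m5
            (Real.rpow_nonneg (h.nonneg _) _) (by positivity)
      _ = _ := by rw [hD]; ring
  exact max_le (one_le_mul_of_one_le_of_one_le hDχ (Real.one_le_rpow hz hθ0)) h4

/-- The subtracted affine function of `n`, with its sign reversed, solves the recursion with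
equality; the deviation from it is multiplied by at most `χ` at each step. -/
theorem log_iteration {χ l k : ℝ} (hχ : 1 < χ) (y : ℕ → ℝ)
    (hy : ∀ n : ℕ, y (n + 1) ≤ χ * (l + n * k + y n)) (n : ℕ) :
    y n ≤ χ ^ n * (y 0 + (χ * l + χ * k / (χ - 1)) / (χ - 1))
      - ((χ * l + χ * k / (χ - 1)) / (χ - 1) + χ * k / (χ - 1) * n) := by
  have hχ0 : χ - 1 ≠ 0 := by linarith
  induction n with
  | zero => simp
  | succ n ih =>
    refine (hy n).trans ?_
    have h1 : χ * (l + n * k + y n) ≤ χ * (l + n * k + (χ ^ n *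
      (y 0 + (χ * l + χ * k / (χ - 1)) / (χ - 1))
      - ((χ * l + χ * k / (χ - 1)) / (χ - 1) + χ * k / (χ - 1) * n))) :=
      mul_le_mul_of_nonneg_left (by linarith) (by linarith)
    refine h1.trans (le_of_eq ?_)
    push_cast
    field_simp
    ring

/-- The energy inequality with `q + s = r_n` leads from order `r_n` to `(r_n - (q - p)) χ`. These
orders grow like `χ^n` once the start `R` exceeds the fixed point, while taking logarithms makes the
moment recursion affine, with growth `χ^n` too. -/
theorem exists_exp_bound (hpp : p.HolderConjugate p') (hpq : p ≤ q) (hχ : 1 < χ) (hC : 1 ≤ C)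
    (hK : 1 ≤ K) (hL : 1 ≤ L) {R B : ℝ} (hpR : p < R) (hqR : q ≤ R)
    (hR : χ * (q - p) < (χ - 1) * R) :
    ∃ a δ, 0 < δ ∧ ∀ M, MomentInequalities p p' q χ C K L M → M R ≤ B →
      ∀ n : ℕ, ∃ r, p ≤ r ∧ δ * χ ^ n ≤ r ∧ M r ≤ Real.exp (a * χ ^ n) := by
  have hp := hpp.lt
  have hp0 := hpp.pos
  have hp'0 := hpp.symm.pos
  have hχ0 : 0 < χ := by linarith
  have hχ1 : 0 < χ - 1 := by linarith
  -- The fixed point of `r ↦ (r - (q - p)) χ`; hypothesis `hR` says that `R` lies above it.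
  set ρ := χ * (q - p) / (χ - 1) with hρ
  have hρ0 : 0 ≤ ρ := div_nonneg (mul_nonneg hχ0.le (by linarith)) hχ1.le
  have hρR : ρ < R := by rw [hρ, div_lt_iff₀ hχ1]; linarith
  -- One factor `2` comes from the sum of two moments in the energy inequality, the other from
  -- adding `L` to the new moment.
  set D := 4 * C * K with hD
  have hD4 : 4 ≤ D := by
    have := one_le_mul_of_one_le_of_one_le hC hK
    rw [hD, mul_assoc]
    linarith
  set l := Real.log (D * R) with hl
  set k := Real.log χ with hk
  set b := (χ * l + χ * k / (χ - 1)) / (χ - 1) with hb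
  have hk0 : 0 ≤ k := Real.log_nonneg hχ.le
  have hl0 : 0 ≤ l := Real.log_nonneg (by nlinarith)
  have hb0 : 0 ≤ b := by positivity
  refine ⟨Real.log (L + B) + b, R - ρ, by linarith, fun M h hMR => ?_⟩
  set r : ℕ → ℝ := fun n => ρ + χ ^ n * (R - ρ) with hr
  have hχn : ∀ n : ℕ, 1 ≤ χ ^ n := fun n => one_le_pow₀ hχ.le
  have hrR : ∀ n, R ≤ r n := by
    intro n
    have := hχn n
    simp only [hr]
    nlinarith
  have hrle : ∀ n, r n ≤ χ ^ n * R := by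
    intro n
    have := hχn n
    simp only [hr]
    nlinarith
  have hrs : ∀ n, r (n + 1) = (r n - (q - p)) * χ := by
    intro n
    have e : ρ * (χ - 1) = χ * (q - p) := div_mul_cancel₀ _ hχ1.ne'
    simp only [hr, pow_succ]
    linear_combination -e
  -- Adding `L` makes `Y n ≥ 1` and, since `M p ≤ L`, lets `Y n` dominate every moment of order
  -- between `p` and `r n`, in particular that of order `r n - (q - p)`.
  set Y : ℕ → ℝ := fun n => L + M (r n) with hY
  have hY1 : ∀ n, 1 ≤ Y n := fun n => by
    have := h.nonneg (r n)
    simp only [hY]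
    linarith
  have hstep : ∀ n, Y (n + 1) ≤ (D * r n * Y n) ^ χ := by
    intro n
    have hrn := hrR n
    have h1 := h.energy (r n - q) (by linarith)
    have e1 : p + (r n - q) = r n - (q - p) := by ring
    have e2 : q + (r n - q) = r n := by ring
    rw [e1, e2, ← hrs n] at h1
    have hm : M (r n - (q - p)) ≤ Y n := by
      refine (h.le_add le_rfl (b := r n) (by linarith) (by linarith) (by linarith)).trans ?_
      exact add_le_add h.base le_rfl
    have hm' : M (r n) ≤ Y n := by
      simp only [hY]
      linarith
    have hYn := hY1 n
    have hK0 : 0 ≤ K := by linarith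
    have hC0 : 0 ≤ C := by linarith
    have hs0 : 0 ≤ r n - (q - p) := by linarith
    have h2 : C * (r n - (q - p)) * (K * (M (r n - (q - p)) + M (r n))) ^ (1 / p)
        * M (r n - (q - p)) ^ (1 / p') ≤ 2 * C * K * r n * Y n := by
      have h3 : (K * (M (r n - (q - p)) + M (r n))) ^ (1 / p) ≤ (2 * K * Y n) ^ (1 / p) := by
        refine Real.rpow_le_rpow (mul_nonneg hK0 (add_nonneg (h.nonneg _) (h.nonneg _))) ?_
          (by positivity)
        nlinarith
      have h4 : M (r n - (q - p)) ^ (1 / p') ≤ (2 * K * Y n) ^ (1 / p') := by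
        refine Real.rpow_le_rpow (h.nonneg _) (hm.trans ?_) (by positivity)
        nlinarith
      have h5 : (2 * K * Y n) ^ (1 / p) * (2 * K * Y n) ^ (1 / p') = 2 * K * Y n := by
        rw [← Real.rpow_add (by positivity)]
        have := hpp.inv_add_inv_eq_one
        rw [one_div, one_div, this, Real.rpow_one]
      calc _ ≤ C * r n * (2 * K * Y n) ^ (1 / p) * (2 * K * Y n) ^ (1 / p') := by
            have h6 : C * (r n - (q - p)) ≤ C * r n :=
              mul_le_mul_of_nonneg_left (by linarith) hC0
            have h7 : 0 ≤ (K * (M (r n - (q - p)) + M (r n))) ^ (1 / p) :=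
              Real.rpow_nonneg (mul_nonneg hK0 (add_nonneg (h.nonneg _) (h.nonneg _))) _
            have h8 : 0 ≤ C * r n := mul_nonneg hC0 (by linarith)
            exact mul_le_mul (mul_le_mul h6 h3 h7 h8) h4 (Real.rpow_nonneg (h.nonneg _) _)
              (mul_nonneg h8 (by positivity))
        _ = C * r n * ((2 * K * Y n) ^ (1 / p) * (2 * K * Y n) ^ (1 / p')) := by ring
        _ = _ := by rw [h5]; ring
    set X := 2 * C * K * r n * Y n with hX
    have hCK := one_le_mul_of_one_le_of_one_le hC hK
    have hX1 : Y n ≤ X := by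
      have : 1 ≤ 2 * (C * K) * r n :=
        one_le_mul_of_one_le_of_one_le (by linarith) (by linarith)
      calc Y n = 1 * Y n := (one_mul _).symm
        _ ≤ 2 * (C * K) * r n * Y n := mul_le_mul_of_nonneg_right this (by linarith)
        _ = X := by rw [hX]; ring
    have hX0 : 1 ≤ X := hYn.trans hX1
    have h9 : M (r (n + 1)) ≤ X ^ χ := by
      refine h1.trans (Real.rpow_le_rpow ?_ h2 hχ0.le)
      exact mul_nonneg (mul_nonneg (mul_nonneg hC0 hs0) (Real.rpow_nonneg
        (mul_nonneg hK0 (add_nonneg (h.nonneg _) (h.nonneg _))) _))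
        (Real.rpow_nonneg (h.nonneg _) _)
    have h10 : L ≤ X ^ χ := by
      have h11 : L ≤ Y n := by
        have := h.nonneg (r n)
        simp only [hY]
        linarith
      have h12 : X ≤ X ^ χ := by
        conv_lhs => rw [← Real.rpow_one X]
        exact Real.rpow_le_rpow_of_exponent_le hX0 hχ.le
      linarith
    have h13 : D * r n * Y n = 2 * X := by rw [hD, hX]; ring
    rw [h13, Real.mul_rpow (by norm_num) (by linarith)]
    have h14 : (2 : ℝ) ≤ 2 ^ χ := by
      conv_lhs => rw [← Real.rpow_one 2]
      exact Real.rpow_le_rpow_of_exponent_le (by norm_num) hχ.le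
    have h15 : 0 ≤ X ^ χ := by positivity
    calc Y (n + 1) = L + M (r (n + 1)) := rfl
      _ ≤ 2 * X ^ χ := by linarith
      _ ≤ _ := mul_le_mul_of_nonneg_right h14 h15
  have hlog : ∀ n : ℕ, Real.log (Y (n + 1)) ≤ χ * (l + n * k + Real.log (Y n)) := by
    intro n
    have hrn := hrR n
    have hYn := hY1 n
    have hR0 : 0 < R := by linarith
    have hrn0 : 0 < r n := by linarith
    have h1 : Y (n + 1) ≤ (D * (χ ^ n * R) * Y n) ^ χ := by
      refine (hstep n).trans (Real.rpow_le_rpow (by positivity) ?_ hχ0.le)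
      exact mul_le_mul_of_nonneg_right (mul_le_mul_of_nonneg_left (hrle n) (by linarith))
        (by linarith)
    refine (Real.log_le_log (by linarith [hY1 (n + 1)]) h1).trans (le_of_eq ?_)
    rw [Real.log_rpow (by positivity), Real.log_mul (by positivity) (by positivity)]
    have e : D * (χ ^ n * R) = χ ^ n * (D * R) := by ring
    rw [e, Real.log_mul (by positivity) (by positivity), Real.log_pow]
    ring
  intro n
  refine ⟨r n, hpR.le.trans (hrR n), ?_, ?_⟩
  · simp only [hr]
    linarith
  · have h1 := log_iteration hχ (fun n => Real.log (Y n)) hlog n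
    have h2 : Real.log (Y n) ≤ (Real.log (L + B) + b) * χ ^ n := by
      have h3 : Real.log (Y 0) ≤ Real.log (L + B) := by
        refine Real.log_le_log (by linarith [hY1 0]) ?_
        have e : r 0 = R := by simp [hr]
        simp only [hY, e]
        linarith
      have h4 : 0 ≤ χ * k / (χ - 1) * n := by positivity
      have h5 := mul_le_mul_of_nonneg_left (add_le_add_left h3 b) (by positivity : 0 ≤ χ ^ n)
      linarith
    have h6 : M (r n) ≤ Y n := by
      simp only [hY]
      linarith
    refine h6.trans ?_
    rw [← Real.exp_log (by linarith [hY1 n] : 0 < Y n)]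
    exact Real.exp_le_exp.2 h2

/-- Moser's iteration. -/
theorem exists_exp_bound_of_subcritical (hpp : p.HolderConjugate p') (hpq : p ≤ q) (hχ : 1 < χ)
    (hC : 1 ≤ C) (hK : 1 ≤ K) (hL : 1 ≤ L) {r : ℝ} (hr : χ * p ≤ r) (hQ : (r / χ - 1) * p' ≤ r)
    (hrq : χ * (q - p) / p < (χ - 1) * r) :
    ∃ a δ, 0 < δ ∧ ∀ M, MomentInequalities p p' q χ C K L M →
      ∀ n : ℕ, ∃ r, p ≤ r ∧ δ * χ ^ n ≤ r ∧ M r ≤ Real.exp (a * χ ^ n) := by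
  have hp := hpp.lt
  have hp0 := hpp.pos
  have hχ1 : 0 < χ - 1 := by linarith
  have hpr : p ≤ r := by nlinarith
  have hq0 : 0 ≤ q / (χ - 1) := div_nonneg (by linarith) hχ1.le
  have hqe : q / (χ - 1) * (χ - 1) = q := div_mul_cancel₀ _ hχ1.ne'
  -- Large enough that `q + s ≤ (p + s) χ`, as the absorption requires, and that `(p + s) χ` exceeds
  -- the threshold `χ (q - p) / (χ - 1)` of the iteration.
  set s := r + q / (χ - 1) with hs
  have hs0 : 0 < s := by linarith
  have hqs : q + s ≤ (p + s) * χ := by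
    have : (p + s) * χ = p * χ + s + r * (χ - 1) + q / (χ - 1) * (χ - 1) := by rw [hs]; ring
    rw [this, hqe]
    nlinarith
  obtain ⟨B₁, hB₁, h1⟩ := exists_bound_of_sobolev (q := q) (K := K) hpp hχ hC hL hr hQ
  obtain ⟨B₂, h2⟩ := exists_bound_of_energy (L := L) hpp hpq hχ hC hK hB₁ hpr hs0.le hrq
    (by linarith) hqs
  obtain ⟨a, δ, hδ, h3⟩ := exists_exp_bound hpp hpq hχ hC hK hL (R := (p + s) * χ) (B := B₂)
    (by linarith) (by linarith) (by
      have : (χ - 1) * ((p + s) * χ) = χ * (p * (χ - 1) + r * (χ - 1) + q / (χ - 1) * (χ - 1)) := by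
        rw [hs]; ring
      rw [this, hqe]
      refine mul_lt_mul_of_pos_left ?_ (by linarith)
      nlinarith)
  exact ⟨a, δ, hδ, fun M h => h3 M h (h2 M h (h1 M h))⟩

end MomentInequalities

/-! ### From moments to the uniform bound -/

theorem integral_abs_rpow_interpolation {p m a t b : ℝ} (hp : 0 < p) {u : E N → ℝ}
    (hu : MemLp u (ENNReal.ofReal p) volume) (hm : ∀ᵐ x, |u x| ≤ m) (ha : p ≤ a) (hab : a < b)
    (hat : a ≤ t) (htb : t ≤ b) :
    ∫ x, |u x| ^ t ≤
      (∫ x, |u x| ^ a) ^ ((b - t) / (b - a)) * (∫ x, |u x| ^ b) ^ ((t - a) / (b - a)) := by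
  have hd : 0 < b - a := by linarith
  have w1 : 0 ≤ (b - t) / (b - a) := div_nonneg (by linarith) hd.le
  have w2 : 0 ≤ (t - a) / (b - a) := div_nonneg (by linarith) hd.le
  have hw : (b - t) / (b - a) + (t - a) / (b - a) = 1 := by
    field_simp
    ring
  have ia := integrable_abs_rpow hp ha hu hm
  have ib := integrable_abs_rpow hp (ha.trans hab.le) hu hm
  have it := integrable_abs_rpow hp (ha.trans hat) hu hm
  have h := ENNReal.lintegral_mul_norm_pow_le ia.1.aemeasurable.ennreal_ofReal
    ib.1.aemeasurable.ennreal_ofReal w1 w2 hw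
  rw [← ofReal_integral_eq_lintegral_ofReal ia (Eventually.of_forall fun x => by positivity),
    ← ofReal_integral_eq_lintegral_ofReal ib (Eventually.of_forall fun x => by positivity),
    ENNReal.ofReal_rpow_of_nonneg (integral_nonneg fun x => by positivity) w1,
    ENNReal.ofReal_rpow_of_nonneg (integral_nonneg fun x => by positivity) w2,
    ← ENNReal.ofReal_mul (by positivity)] at h
  rw [← ENNReal.ofReal_le_ofReal_iff (by positivity),
    ofReal_integral_eq_lintegral_ofReal it (Eventually.of_forall fun x => by positivity)]
  refine le_trans (le_of_eq (lintegral_congr fun x => ?_)) h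
  rw [ENNReal.ofReal_rpow_of_nonneg (by positivity) w1,
    ENNReal.ofReal_rpow_of_nonneg (by positivity) w2, ← ENNReal.ofReal_mul (by positivity),
    ← Real.rpow_mul (abs_nonneg _), ← Real.rpow_mul (abs_nonneg _),
    ← Real.rpow_add_of_nonneg (abs_nonneg _) (mul_nonneg (by linarith) w1)
      (mul_nonneg (by linarith) w2)]
  congr 2
  field_simp
  ring

/-- Chebyshev with the `r`-th moment at level `exp (max a 0 / δ + η)` bounds the measure of the
superlevel set by `exp (-δ η χ^n)`, which tends to `0`. The maximum with `0` makes the exponent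
nonnegative, so that `r` may be replaced by its lower bound `δ χ^n`. -/
theorem ae_abs_le_of_moment_bounds {p m a δ χ : ℝ} (hp : 0 < p) (hδ : 0 < δ) (hχ : 1 < χ)
    {u : E N → ℝ} (hu : MemLp u (ENNReal.ofReal p) volume) (hm : ∀ᵐ x, |u x| ≤ m)
    (h : ∀ n : ℕ, ∃ r, p ≤ r ∧ δ * χ ^ n ≤ r ∧ ∫ x, |u x| ^ r ≤ Real.exp (a * χ ^ n)) :
    ∀ᵐ x, |u x| ≤ Real.exp (max a 0 / δ) := by
  have key : ∀ η : ℝ, 0 < η → volume {x : E N | Real.exp (max a 0 / δ + η) ≤ |u x|} = 0 := by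
    intro η hη
    set lam := Real.exp (max a 0 / δ + η) with hl
    have hfin : volume {x : E N | lam ≤ |u x|} ≠ ⊤ := by
      have i := integrable_abs_rpow hp le_rfl hu hm
      have h1 := i.measure_ge_lt_top (ε := lam ^ p) (by positivity)
      refine ne_top_of_le_ne_top h1.ne (measure_mono fun x hx => ?_)
      exact Real.rpow_le_rpow (by positivity) hx hp.le
    have hb : ∀ n : ℕ, volume.real {x : E N | lam ≤ |u x|} ≤ Real.exp (-(δ * η * χ ^ n)) := by
      intro n
      obtain ⟨r, hpr, hδr, hr⟩ := h n
      have hr0 : 0 < r := by linarith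
      have h1 := mul_meas_ge_le_integral_of_nonneg (μ := volume)
        (f := fun x => |u x| ^ r) (Eventually.of_forall fun x => by positivity)
        (integrable_abs_rpow hp hpr hu hm) (lam ^ r)
      have h2 : {x : E N | lam ^ r ≤ |u x| ^ r} = {x : E N | lam ≤ |u x|} := by
        ext x
        exact Real.rpow_le_rpow_iff (by positivity) (abs_nonneg _) hr0
      rw [h2] at h1
      have h3 : lam ^ r = Real.exp ((max a 0 / δ + η) * r) := by rw [hl, Real.exp_mul]
      have hn : 0 ≤ volume.real {x : E N | lam ≤ |u x|} := measureReal_nonneg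
      have h4 : a * χ ^ n + δ * η * χ ^ n ≤ (max a 0 / δ + η) * r := by
        have h5 : (max a 0 / δ + η) * (δ * χ ^ n) ≤ (max a 0 / δ + η) * r := by
          gcongr
        have h6 : (max a 0 / δ + η) * (δ * χ ^ n) = max a 0 * χ ^ n + δ * η * χ ^ n := by
          field_simp
        have h7 : a * χ ^ n ≤ max a 0 * χ ^ n := by
          gcongr
          exact le_max_left _ _
        linarith
      have h8 : Real.exp (a * χ ^ n + δ * η * χ ^ n) * volume.real {x : E N | lam ≤ |u x|}
          ≤ Real.exp (a * χ ^ n) := by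
        refine le_trans (mul_le_mul_of_nonneg_right ?_ hn) (h1.trans hr)
        rw [h3]
        exact Real.exp_le_exp.2 h4
      rw [Real.exp_add, mul_assoc] at h8
      have h9 := le_of_mul_le_mul_left (h8.trans (mul_one _).ge) (Real.exp_pos _)
      rw [Real.exp_neg, ← one_div, le_div_iff₀ (Real.exp_pos _), mul_comm]
      exact h9
    have hlim : Tendsto (fun n : ℕ => Real.exp (-(δ * η * χ ^ n))) atTop (𝓝 0) :=
      Real.tendsto_exp_neg_atTop_nhds_zero.comp
        ((tendsto_pow_atTop_atTop_of_one_lt hχ).const_mul_atTop (by positivity))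
    have h0 := ge_of_tendsto' hlim hb
    have h1 : volume.real {x : E N | lam ≤ |u x|} = 0 := le_antisymm h0 measureReal_nonneg
    exact (measureReal_eq_zero_iff hfin).1 h1
  have hall : ∀ᵐ x : E N, ∀ n : ℕ, |u x| < Real.exp (max a 0 / δ + 1 / ((n : ℝ) + 1)) := by
    refine ae_all_iff.2 fun n => ?_
    have := key (1 / ((n : ℝ) + 1)) (by positivity)
    rw [ae_iff]
    simpa only [not_lt] using this
  filter_upwards [hall] with x hx
  have hlim : Tendsto (fun n : ℕ => Real.exp (max a 0 / δ + 1 / ((n : ℝ) + 1))) atTop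
      (𝓝 (Real.exp (max a 0 / δ + 0))) :=
    (Real.continuous_exp.tendsto _).comp
      (tendsto_const_nhds.add tendsto_one_div_add_atTop_nhds_zero_nat)
  rw [add_zero] at hlim
  exact ge_of_tendsto' hlim fun n => (hx n).le

/-- With `χ = N/(N-1)` the last condition reads `N (q - p) < p r`. If `p < N`, the choice `r = p^*`
gives equality in the second condition and turns the last one into `q < p^*`. If `p ≥ N`, then `p' ≤
χ`, the second condition always holds and `r` may be as large as desired. -/
theorem exists_subcritical_exponent (hN : 2 ≤ N) {p q p' χ : ℝ} (hpp : p.HolderConjugate p')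
    (hq : (q : EReal) < criticalExponent N p) (hχ : (N : ℝ).HolderConjugate χ) :
    ∃ r, χ * p ≤ r ∧ (r / χ - 1) * p' ≤ r ∧ χ * (q - p) / p < (χ - 1) * r := by
  have hp := hpp.lt
  have hp0 := hpp.pos
  have hN2 : (2 : ℝ) ≤ N := by exact_mod_cast hN
  have hχe : χ = N / (N - 1) := hχ.conjExponent_eq.symm
  have hpe : p' = p / (p - 1) := hpp.conjExponent_eq.symm
  have hp1 : 0 < p - 1 := by linarith
  have hN1 : 0 < (N : ℝ) - 1 := by linarith
  have hN0 : (0 : ℝ) < N := by linarith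
  have hχ1 : χ - 1 = 1 / (N - 1) := by rw [hχe]; field_simp; ring
  have hred : ∀ r : ℝ, N * (q - p) < p * r → χ * (q - p) / p < (χ - 1) * r := by
    intro r hr
    rw [hχ1, hχe, div_lt_iff₀ hp0]
    have e1 : (N : ℝ) / (N - 1) * (q - p) = N * (q - p) / (N - 1) := by ring
    have e2 : 1 / ((N : ℝ) - 1) * r * p = p * r / (N - 1) := by ring
    rw [e1, e2]
    exact div_lt_div_of_pos_right hr hN1
  by_cases hpN : p < N
  · rw [criticalExponent, if_pos hpN, EReal.coe_lt_coe_iff] at hq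
    have hd : 0 < (N : ℝ) - p := by linarith
    refine ⟨N * p / (N - p), ?_, ?_, hred _ ?_⟩
    · rw [hχe, div_mul_eq_mul_div]
      exact div_le_div_of_nonneg_left (by positivity) hd (by linarith)
    · rw [hχe, hpe]
      refine le_of_eq ?_
      field_simp
      ring
    · have h1 : q - p < p ^ 2 / (N - p) := by
        have : p ^ 2 / (N - p) = N * p / (N - p) - p := by field_simp; ring
        linarith
      have h2 := mul_lt_mul_of_pos_left h1 hN0
      refine h2.trans_eq ?_
      ring
  · refine ⟨max (χ * p) (N * (q - p) / p + 1), le_max_left _ _, ?_, hred _ ?_⟩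
    · set r := max (χ * p) (N * (q - p) / p + 1)
      have hr0 : 0 < r := lt_of_lt_of_le (mul_pos hχ.symm.pos hp0) (le_max_left _ _)
      have h1 : p' / χ ≤ 1 := by
        rw [hχe, hpe, div_div_div_eq, div_le_one (by positivity)]
        nlinarith
      have h2 : 0 < p' := hpp.symm.pos
      calc (r / χ - 1) * p' = p' / χ * r - p' := by ring
        _ ≤ 1 * r - p' := by gcongr
        _ ≤ r := by linarith
    · have h1 : N * (q - p) / p < max (χ * p) (N * (q - p) / p + 1) :=
        lt_of_lt_of_le (by linarith) (le_max_right _ _)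
      rwa [div_lt_iff₀ hp0, mul_comm _ p] at h1

/-- Both recursive inequalities are the Sobolev inequality for powers: with weight `s = 0` and the
gradient bound `L`, or with `β = p + s`, for which the Hölder exponent `Q` is again `p + s`. -/
theorem momentInequalities_of_energy {p q p' m C K L : ℝ} {χ : NNReal}
    (hpp : p.HolderConjugate p') (hχ : NNReal.HolderConjugate N χ)
    {Ω : Set (E N)} (hΩ : volume Ω ≠ ⊤) {u : E N → ℝ} (hu : MemWZero p Ω u)
    (hm : ∀ᵐ x, |u x| ≤ m)
    (hC : eLpNormLESNormFDerivOneConst (volume : Measure (E N)) χ ≤ C)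
    (hL : ∫ x, |u x| ^ p ≤ L) (hL' : ∫ x, ‖weakGrad u x‖ ^ p ≤ L)
    (hK : ∀ s, 0 ≤ s → ∫ x, |u x| ^ s * ‖weakGrad u x‖ ^ p ≤
      K * ((∫ x, |u x| ^ (p + s)) + ∫ x, |u x| ^ (q + s))) :
    MomentInequalities p p' q χ C K L fun r => ∫ x, |u x| ^ r := by
  have hp := hpp.lt
  have hp0 := hpp.pos
  have hp'0 := hpp.symm.pos
  have hχ0 : 0 < (χ : ℝ) := by exact_mod_cast hχ.symm.pos
  have hχ1 : 1 < (χ : ℝ) := by exact_mod_cast hχ.symm.lt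
  have hC0 : 0 ≤ C := le_trans NNReal.zero_le_coe hC
  have hnn : ∀ r : ℝ, 0 ≤ ∫ x, |u x| ^ r := fun r => integral_nonneg fun x => by positivity
  have hpow : ∀ {a b : ℝ}, 0 ≤ a → a ^ (1 / (χ : ℝ)) ≤ b → a ≤ b ^ (χ : ℝ) := by
    intro a b ha hab
    have := Real.rpow_le_rpow (by positivity) hab hχ0.le
    rwa [← Real.rpow_mul ha, one_div_mul_cancel hχ0.ne', Real.rpow_one] at this
  refine ⟨hnn, hL, fun a t b ha hab hat htb =>
    integral_abs_rpow_interpolation hp0 hu.1.1 hm ha hab hat htb, ?_, ?_⟩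
  · intro β hβ hQ hβχ
    have h := hu.rpow_integral_le hp hΩ hm hχ (s := 0) hβ le_rfl hpp
      (Q := (β - 1) * p') (by simp) hQ hβχ
    simp only [Real.rpow_zero, one_mul] at h
    refine hpow (hnn _) (h.trans ?_)
    gcongr
  · intro s hs
    have hQ : p + s = (p + s - 1 - s / p) * p' := by
      have h1 := hpp.sub_one_mul_conj
      have e : p + s - 1 - s / p = (p - 1) * (1 + s / p) := by field_simp; ring
      rw [e, mul_right_comm, h1]
      field_simp
    have h := hu.rpow_integral_le hp hΩ hm hχ (β := p + s) (by linarith) hs hpp hQ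
      (by linarith) (by nlinarith)
    refine hpow (hnn _) (h.trans ?_)
    have h0 : 0 ≤ ∫ x, |u x| ^ s * ‖weakGrad u x‖ ^ p := integral_nonneg fun x => by positivity
    gcongr
    exact hK s hs

/-- The `r`-th root of `Λ^r S` is `Λ S^(1/r) ≤ Λ S`, because `S ≥ 1`; this removes the dependence on
`r`. -/
theorem MemXZero.memLV {V : E N → ℝ} {p r Λ S : ℝ} {Ω : Set (E N)} {u : E N → ℝ}
    (hp : 1 < p) (hr : p ≤ r)
    (hV1 : HypV1 V) (hu : MemXZero V p Ω u) (hΛ : 1 ≤ Λ) (hb : ∀ᵐ x, |u x| ≤ Λ) (hS : 1 ≤ S)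
    (hVS : ∫ x, V x * |u x| ^ p ≤ S) : MemLV V r u ∧ normLV V r u ≤ Λ * S := by
  have hp0 : 0 < p := by linarith
  have hr0 : 0 < r := by linarith
  have hum := hu.1.1.1.1
  obtain ⟨c, hc, hV⟩ := hV1
  have e : ∀ x, V x * |u x| ^ r = |u x| ^ (r - p) * (V x * |u x| ^ p) := by
    intro x
    rw [mul_left_comm, ← Real.rpow_add_of_nonneg (abs_nonneg _) (by linarith) hp0.le]
    ring_nf
  have hbr : ∀ᵐ x, |u x| ^ (r - p) ≤ Λ ^ r := by
    filter_upwards [hb] with x hx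
    exact (Real.rpow_le_rpow (abs_nonneg _) hx (by linarith)).trans
      (Real.rpow_le_rpow_of_exponent_le hΛ (by linarith))
  have i : Integrable (fun x => V x * |u x| ^ r) volume := by
    simp only [e]
    refine integrable_bdd_mul (C := Λ ^ r)
      (hum.norm.aemeasurable.pow_const _).aestronglyMeasurable ?_ hu.2.1
    filter_upwards [hbr] with x hx
    rwa [abs_of_nonneg (by positivity)]
  have hle : ∫ x, V x * |u x| ^ r ≤ Λ ^ r * S := by
    have h1 : ∫ x, V x * |u x| ^ r ≤ ∫ x, Λ ^ r * (V x * |u x| ^ p) := by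
      refine integral_mono_ae i (hu.2.1.const_mul _) ?_
      filter_upwards [hbr, hV] with x hx hVx
      simp only [e]
      have : 0 ≤ V x := by linarith
      gcongr
    rw [integral_const_mul] at h1
    exact h1.trans (by gcongr)
  have hnn : 0 ≤ ∫ x, V x * |u x| ^ r := by
    refine integral_nonneg_of_ae ?_
    filter_upwards [hV] with x hVx
    have : 0 ≤ V x := by linarith
    rw [Pi.zero_apply]
    positivity
  refine ⟨⟨?_, i⟩, ?_⟩
  · have h1 := integrable_abs_rpow hp0 hr hu.1.1.1 hb
    rw [← integrable_norm_rpow_iff hum (by simpa using hr0) ENNReal.ofReal_ne_top,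
      ENNReal.toReal_ofReal hr0.le]
    exact h1
  · rw [normLV]
    have h1 := Real.rpow_le_rpow hnn hle (z := 1 / r) (by positivity)
    refine h1.trans ?_
    rw [Real.mul_rpow (by positivity) (by linarith), ← Real.rpow_mul (by linarith),
      mul_one_div_cancel hr0.ne', Real.rpow_one]
    gcongr
    conv_rhs => rw [← Real.rpow_one S]
    refine Real.rpow_le_rpow_of_exponent_le hS ?_
    rw [div_le_one hr0]
    linarith

end QuasilinearSchrodinger

end

/-! ### The uniform bound for the sequence of critical points. -/

open QuasilinearSchrodinger in
theorem proposition6p3 {N : ℕ} (hN : 2 ≤ N) (p q μ α₀ τ : ℝ) (hp : 1 < p)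
    (A : E N → ℝ → ℝ) (V : E N → ℝ) (g : E N → ℝ → ℝ)
    (hV : AEMeasurable V MeasureTheory.volume)
    (hV1 : HypV1 V) (hV2 : HypV2 V) (hV3 : HypV3 V)
    (hA0 : IsCaratheodory 1 A) (hA1 : HypH1 A) (hA2 : HypH2 α₀ A) (hA3 : HypH3 p μ A)
    (hA4 : HypH4 p A)
    (hg0 : IsCaratheodory 0 g) (hg1 : HypG1 p q g) (hτ : IsEmbeddingConst V p τ)
    (hg2 : HypG2 p α₀ τ g) (hg3 : HypG3 μ g)
    (hq : (q : EReal) < criticalExponent N p)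
    (ϱ αlow αup : ℝ) (ustar : E N → ℝ)
    (hgeom : MountainPassGeometry p A V g ϱ αlow ustar)
    (hαup : IsGreatest ((fun s : ℝ => J p A V g (fun x => s * ustar x)) '' Set.Icc 0 1) αup)
    (u : ℕ → E N → ℝ) (hu : IsMountainPassSequence p A V g αlow αup u) :
    ∃ M₀ : ℝ, 0 < M₀ ∧
      (∀ k : ℕ, 1 ≤ k → MemX V p (u k) ∧ normX V p (u k) ≤ M₀) ∧
      (∀ r : ℝ, p ≤ r → ∀ k : ℕ, 1 ≤ k →
        MemLV V r (u k) ∧ normLV V r (u k) ≤ M₀) := by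
  obtain ⟨hμ, α₁, hα₁, hA3⟩ := hA3
  obtain ⟨α₂, hα₂, hA4⟩ := hA4
  obtain ⟨hpq, a₁, ha₁, a₂, ha₂, hg1⟩ := hg1
  have hV1' := hV1
  obtain ⟨c, hc, hVc⟩ := hV1'
  have hα₀ := hA2.1
  have hp0 : 0 < p := by linarith
  have hμ0 : 0 < μ := by linarith
  have hμp : 0 < μ - p := by linarith
  have hpp : p.HolderConjugate (Real.conjExponent p) := Real.HolderConjugate.conjExponent hp
  have hN1 : (1 : NNReal) < N := by exact_mod_cast (by omega : 1 < N)
  have hχ : NNReal.HolderConjugate N (NNReal.conjExponent N) :=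
    NNReal.HolderConjugate.conjExponent hN1
  set χ := NNReal.conjExponent N
  have hχr : (N : ℝ).HolderConjugate χ := by simpa using hχ.coe
  obtain ⟨r₀, hr₁, hr₂, hr₃⟩ := exists_subcritical_exponent hN hpp hq hχr
  set C := max (1 : ℝ) (eLpNormLESNormFDerivOneConst (MeasureTheory.volume :
    MeasureTheory.Measure (E N)) χ)
  set κ := α₂ * α₀ / p with hκ
  have hκ0 : 0 < κ := by positivity
  set K := max 1 (max a₁ a₂ / κ) with hK
  -- `μ αup` divided by each of the two coefficients in the energy estimate. Below, `L` also
  -- includes `S / c`, the resulting bound for `∫ |u|^p` when `V ≥ c`.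
  set S := max 1 (max (μ * αup / (α₁ * α₀ / p)) (μ * αup / ((μ - p) / p))) with hS
  have hS1 : 1 ≤ S := le_max_left _ _
  set L := max S (S / c)
  have hL1 : 1 ≤ L := hS1.trans (le_max_left _ _)
  obtain ⟨a, δ, hδ, hbound⟩ := MomentInequalities.exists_exp_bound_of_subcritical hpp hpq
    hχr.symm.lt (C := C) (K := K) (L := L) (le_max_left _ _) (le_max_left _ _) hL1 hr₁ hr₂ hr₃
  set Λ := Real.exp (max a 0 / δ) with hΛ
  have hΛ1 : 1 ≤ Λ := Real.one_le_exp (div_nonneg (le_max_right _ _) hδ.le)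
  have main : ∀ k : ℕ, 1 ≤ k → (∫ x, ‖weakGrad (u k) x‖ ^ p) ≤ S ∧
      (∫ x, V x * |u k x| ^ p) ≤ S ∧ ∀ᵐ x, |u k x| ≤ Λ := by
    intro k hk
    have hX := hu.mem k hk
    -- This `m` depends on `k`; it serves only for integrability and test functions and enters none
    -- of the constants `S`, `L`, `Λ`.
    obtain ⟨m, hm0, hm⟩ := exists_ae_abs_le hX.2.2
    have hen := energy_le_of_critical hp hpq hα₁ hA0 hA1 hA2 hμ hA3 hg0 hg1 hg3 hX hm hm0
      (hu.critical k hk _ hX)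
    have hJ := mul_le_mul_of_nonneg_left (hu.level_le k hk) hμ0.le
    have n1 : 0 ≤ ∫ x, ‖weakGrad (u k) x‖ ^ p :=
      MeasureTheory.integral_nonneg fun x => by positivity
    have hVn : ∀ᵐ x, 0 ≤ V x * |u k x| ^ p := by
      filter_upwards [hVc] with x hx
      have : 0 ≤ V x := by linarith
      positivity
    have n2 : 0 ≤ ∫ x, V x * |u k x| ^ p := MeasureTheory.integral_nonneg_of_ae hVn
    have k1 : 0 < α₁ * α₀ / p := by positivity
    have k2 : 0 < (μ - p) / p := by positivity
    have b1 : (∫ x, ‖weakGrad (u k) x‖ ^ p) ≤ S := by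
      refine le_trans ?_ ((le_max_left _ _).trans (le_max_right _ _))
      rw [le_div_iff₀ k1]
      linarith [mul_nonneg k2.le n2]
    have b2 : (∫ x, V x * |u k x| ^ p) ≤ S := by
      refine le_trans ?_ ((le_max_right _ _).trans (le_max_right _ _))
      rw [le_div_iff₀ k2]
      linarith [mul_nonneg k1.le n1]
    have b3 : (∫ x, |u k x| ^ p) ≤ L := by
      refine le_trans ?_ (le_max_right _ _)
      rw [le_div_iff₀ hc, mul_comm, ← MeasureTheory.integral_const_mul]
      refine le_trans (MeasureTheory.integral_mono_ae
        ((integrable_abs_rpow hp0 le_rfl hX.1.1.1 hm).const_mul c) hX.2.1 ?_) b2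
      filter_upwards [hVc] with x hx
      gcongr
    refine ⟨b1, b2, ?_⟩
    have hfin : MeasureTheory.volume (Metric.ball (0 : E N) k) ≠ ⊤ :=
      Metric.isBounded_ball.measure_lt_top.ne
    refine ae_abs_le_of_moment_bounds hp0 hδ hχr.symm.lt hX.1.1.1 hm (hbound _
      (momentInequalities_of_energy hpp hχ hfin hX.1 hm (le_max_right _ _) b3
        (b1.trans (le_max_left _ _)) fun s hs => ?_))
    have h1 := power_energy_le hp hpq hα₂ ha₁ ha₂ hA0 hA1 hA2 hA4 hV hV1 hg0 hg1 hX hm hm0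
      (hu.critical k hk) hs
    have m1 : 0 ≤ ∫ x, |u k x| ^ (p + s) := MeasureTheory.integral_nonneg fun x => by positivity
    have m2 : 0 ≤ ∫ x, |u k x| ^ (q + s) := MeasureTheory.integral_nonneg fun x => by positivity
    have h2 : max a₁ a₂ ≤ κ * K := by
      have := mul_le_mul_of_nonneg_left (le_max_right 1 (max a₁ a₂ / κ)) hκ0.le
      rwa [mul_div_cancel₀ _ hκ0.ne'] at this
    refine le_of_mul_le_mul_left (h1.trans ?_) hκ0
    rw [← mul_assoc, mul_add]
    exact add_le_add (mul_le_mul_of_nonneg_right ((le_max_left _ _).trans h2) m1)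
      (mul_le_mul_of_nonneg_right ((le_max_right _ _).trans h2) m2)
  have hΛS : Λ ≤ Λ * S := le_mul_of_one_le_right (by linarith) hS1
  -- `2 * S` bounds `‖u_k‖_V`, as `(2S)^(1/p) ≤ 2S`; `Λ * S` bounds both `|u_k|_∞` and every
  -- `|u_k|_{V,r}`.
  refine ⟨2 * S + Λ * S, by linarith, fun k hk => ?_, fun r hr k hk => ?_⟩
  · obtain ⟨b1, b2, b3⟩ := main k hk
    have hX := hu.mem k hk
    refine ⟨⟨⟨hX.1.1, hX.2.1⟩, hX.2.2⟩, add_le_add ?_ ?_⟩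
    · have n1 : 0 ≤ (∫ x, ‖weakGrad (u k) x‖ ^ p) + ∫ x, V x * |u k x| ^ p := by
        refine add_nonneg (MeasureTheory.integral_nonneg fun x => by positivity)
          (MeasureTheory.integral_nonneg_of_ae ?_)
        filter_upwards [hVc] with x hx
        have : 0 ≤ V x := by linarith
        rw [Pi.zero_apply]
        positivity
      rw [normV]
      refine (Real.rpow_le_rpow n1 (by linarith : _ ≤ 2 * S) (by positivity)).trans ?_
      conv_rhs => rw [← Real.rpow_one (2 * S)]
      refine Real.rpow_le_rpow_of_exponent_le (by linarith) ?_
      rw [div_le_one hp0]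
      exact hp.le
    · refine le_trans ?_ hΛS
      rw [normLinf]
      refine ENNReal.toReal_le_of_le_ofReal (by linarith) ?_
      rw [MeasureTheory.eLpNorm_exponent_top]
      exact MeasureTheory.eLpNormEssSup_le_of_ae_bound b3
  · obtain ⟨-, b2, b3⟩ := main k hk
    obtain ⟨h1, h2⟩ := (hu.mem k hk).memLV hp hr hV1 hΛ1 b3 hS1 b2
    exact ⟨h1, h2.trans (by linarith)⟩
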